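/- Let $n\ge 0$ and let $S_n$ be the set of permutations $x=x_1x_2\cdots x_n$ of $\{1,\dots,n\}$, partially ordered by the weak order, whose cover relations are $x\lessdot y$ whenever $y$ is obtained from $x$ by swapping two adjacent entries $x_i<x_{i+1}$. This is a finite lattice. A descent of $x$ is an index $i$ with $x_i>x_{i+1}$. The canonical join representation of $x$ is the irredundant expression $x=\bigvee S$ such that, whenever $x=\bigvee T$, every $s\in S$ lies below some $t\in T$. Place the points $1,\dots,n$ on a vertical line, with $1$ at the bottom. An arc is a curve moving monotonically upwards from a point $p$ to a strictly higher point $q$ and passing to the left or to the right of each point strictly between them; arcs are considered up to combinatorial equivalence, that is, an arc is determined by $p$, $q$ and the set of points between $p$ and $q$ to its left. A noncrossing arc diagram is a set of arcs that can be drawn simultaneously so that no two of them intersect except possibly at their endpoints, and such that no two of them share the same upper endpoint or the same lower endpoint. An arc $\alpha_1$ from $p_1$ to $q_1$ is a subarc of an arc $\alpha_2$ from $p_2$ to $q_2$ if $p_2\le p_1<q_1\le q_2$ and the set of points left of $\alpha_1$ equals the set of points of $\{p_1+1,\dots,q_1-1\}$ left of $\alpha_2$. A join-irreducible permutation $j$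 has a unique descent $j_i=b>a=j_{i+1}$; it corresponds to the arc from $a$ to $b$ for which a point $c$ with $a<c<b$ is to the left of the arc if and only if $c$ occurs before the descent in $j$. This is a bijection from join-irreducible permutations to arcs. Let $\delta$ be the map sending a permutation to the set of arcs corresponding to the elements of its canonical join representation. A permutation is contracted by a lattice congruence $\Theta$ on $S_n$ if it is congruent modulo $\Theta$ to some permutation strictly below it, and uncontracted otherwise. Let $U$ be a set of arcs. Then $U$ is the set of arcs corresponding to the uncontracted join-irreducible permutations of some lattice congruence $\Theta$ on $S_n$ if and only if $U$ is closed under passing to subarcs. In this case, for every such $\Theta$, the map $\delta$ restricts to a bijection from the set of permutations not contracted by $\Theta$ to the set of noncrossing arc diagrams consisting only of arcs in $U$. Moreover, for each $k\ge 0$, $\delta$ restricts to a bijection from the set of uncontracted permutations with exactly $k$ descents to the set of noncrossing arc diagrams consisting of exactly $k$ arcs, all of which are in $U$. -/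

import Mathlib

/-! ### Permutations and the weak order -/

/-- Permutations `x_1 x_2 ⋯ x_n`, written in one-line notation.  Positions and values are indexed by
`Fin n` (that is, `0, …, n - 1` instead of `1, …, n`); `x.toPerm i` is the entry in position `i`
and `x.toPerm.symm c` is the position of the value `c`. -/
@[ext]
structure WeakPerm (n : ℕ) where
  toPerm : Equiv.Perm (Fin n)

namespace WeakPerm

variable {n : ℕ}

/-- The cover relations of the weak order: `y` is obtained from `x` by swapping two adjacent
entries `x_i < x_{i+1}`. -/
def Step (x y : WeakPerm n) : Prop :=
  ∃ i j : Fin n, (j : ℕ) = i + 1 ∧ x.toPerm i < x.toPerm j ∧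
    y.toPerm i = x.toPerm j ∧ y.toPerm j = x.toPerm i ∧
    ∀ k, k ≠ i → k ≠ j → y.toPerm k = x.toPerm k

/-- `(b, a)` is an inversion of `x`: `b > a` and `b` occurs before `a`. -/
def Inv (x : WeakPerm n) (b a : Fin n) : Prop :=
  a < b ∧ x.toPerm.symm b < x.toPerm.symm a

theorem inv_of_step {x y : WeakPerm n} (i j : Fin n) (hij : (j : ℕ) = i + 1)
    (hlt : x.toPerm i < x.toPerm j) (hi : y.toPerm i = x.toPerm j) (hj : y.toPerm j = x.toPerm i)
    (hk : ∀ k, k ≠ i → k ≠ j → y.toPerm k = x.toPerm k) (b a : Fin n) :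
    y.Inv b a ↔ x.Inv b a ∨ (b = x.toPerm j ∧ a = x.toPerm i) := by
  have key : ∀ p, y.toPerm.symm (x.toPerm p) = Equiv.swap i j p := by
    intro p
    rw [Equiv.symm_apply_eq]
    by_cases h1 : p = i
    · subst h1; simp [hj]
    · by_cases h2 : p = j
      · subst h2; simp [hi]
      · rw [Equiv.swap_apply_of_ne_of_ne h1 h2, hk p h1 h2]
  obtain ⟨p, rfl⟩ := x.toPerm.surjective b
  obtain ⟨q, rfl⟩ := x.toPerm.surjective a
  simp only [Inv, key, Equiv.symm_apply_apply, EmbeddingLike.apply_eq_iff_eq, Equiv.swap_apply_def]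
  have hji : j ≠ i := by rintro rfl; omega
  by_cases p1 : p = i
  · subst p1
    by_cases q1 : q = p
    · subst q1; simp [hji.symm]
    · by_cases q2 : q = j
      · subst q2; simp only [hji, if_true, if_false, Fin.lt_def] at *; simp; omega
      · simp only [q1, q2, hji.symm, if_true, if_false]
        clear key hi hj hk; grind
  · by_cases p2 : p = j
    · subst p2
      by_cases q1 : q = i
      · subst q1; simp only [hji, if_true, if_false, Fin.lt_def] at *; simp; omega
      · by_cases q2 : q = p
        · subst q2; simp [hji]
        · simp only [q1, q2, hji, if_true, if_false]
          clear key hi hj hk; grind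
    · by_cases q1 : q = i
      · subst q1
        simp only [p1, p2, if_true, if_false]
        clear key hi hj hk; grind
      · by_cases q2 : q = j
        · subst q2
          simp only [p1, p2, hji, if_true, if_false]
          clear key hi hj hk; grind
        · simp [p1, p2, q1, q2]

theorem inv_mono_of_step {x y : WeakPerm n} (h : Step x y) {b a : Fin n} (hx : x.Inv b a) :
    y.Inv b a := by
  obtain ⟨i, j, hij, hlt, hi, hj, hk⟩ := h
  exact (inv_of_step i j hij hlt hi hj hk b a).2 (Or.inl hx)

theorem eq_of_strictMono {x y : WeakPerm n}
    (h : StrictMono fun k => y.toPerm.symm (x.toPerm k)) : x = y := by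
  have hs : Function.Surjective fun k => y.toPerm.symm (x.toPerm k) :=
    y.toPerm.symm.surjective.comp x.toPerm.surjective
  have e := Subsingleton.elim (StrictMono.orderIsoOfSurjective _ h hs) (OrderIso.refl (Fin n))
  ext k
  have := congrArg (fun f : Fin n ≃o Fin n => f k) e
  simp only [StrictMono.coe_orderIsoOfSurjective, OrderIso.refl_apply] at this
  rw [Equiv.symm_apply_eq] at this
  rw [this]

theorem eq_of_inv_iff {x y : WeakPerm n} (h : ∀ b a, x.Inv b a ↔ y.Inv b a) : x = y := by
  apply eq_of_strictMono
  intro p q hpq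
  have hne : x.toPerm p ≠ x.toPerm q := fun e => hpq.ne (x.toPerm.injective e)
  rcases lt_or_gt_of_ne hne with hlt | hlt
  · by_contra hc
    have hc' : y.toPerm.symm (x.toPerm q) < y.toPerm.symm (x.toPerm p) :=
      lt_of_le_of_ne (not_lt.1 hc) fun e => hne (y.toPerm.symm.injective e).symm
    have := ((h _ _).2 ⟨hlt, hc'⟩).2
    simp only [Equiv.symm_apply_apply] at this
    exact lt_asymm this hpq
  · exact ((h _ _).1 ⟨hlt, by simpa using hpq⟩).2

theorem exists_step {x y : WeakPerm n} (h : ∀ b a, x.Inv b a → y.Inv b a) (hne : x ≠ y) :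
    ∃ z, Step x z ∧ ∃ b a, ¬ x.Inv b a ∧ y.Inv b a ∧
      ∀ d c, z.Inv d c ↔ x.Inv d c ∨ (d = b ∧ c = a) := by
  have hex : ∃ i j : Fin n, (j : ℕ) = i + 1 ∧
      y.toPerm.symm (x.toPerm j) < y.toPerm.symm (x.toPerm i) := by
    by_contra hc
    push Not at hc
    apply hne
    apply eq_of_strictMono
    cases n with
    | zero => intro p; exact p.elim0
    | succ m =>
      rw [Fin.strictMono_iff_lt_succ]
      intro i
      refine lt_of_le_of_ne (hc i.castSucc i.succ (by simp)) fun e => ?_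
      have := x.toPerm.injective (y.toPerm.symm.injective e)
      simp [Fin.ext_iff] at this
  obtain ⟨i, j, hij, hlt⟩ := hex
  have hij' : i < j := by rw [Fin.lt_def]; omega
  have hx : x.toPerm i < x.toPerm j := by
    by_contra hc
    have hc' : x.toPerm j < x.toPerm i :=
      lt_of_le_of_ne (not_lt.1 hc) fun e => hij'.ne (x.toPerm.injective e).symm
    exact lt_asymm hlt (h _ _ ⟨hc', by simpa using hij'⟩).2
  refine ⟨⟨(Equiv.swap i j).trans x.toPerm⟩, ?_, x.toPerm j, x.toPerm i, ?_, ⟨hx, hlt⟩, ?_⟩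
  · refine ⟨i, j, hij, hx, by simp, by simp, fun k h1 h2 => ?_⟩
    simp [Equiv.swap_apply_of_ne_of_ne h1 h2]
  · rintro ⟨-, hc⟩
    simp only [Equiv.symm_apply_apply] at hc
    exact lt_asymm hc hij'
  · refine inv_of_step i j hij hx (by simp) (by simp) fun k h1 h2 => ?_
    simp [Equiv.swap_apply_of_ne_of_ne h1 h2]

/-- The weak order is the reflexive and transitive closure of its cover relations. -/
instance : LE (WeakPerm n) := ⟨Relation.ReflTransGen Step⟩

/-- The weak order is containment of inversion sets. -/
theorem le_iff_inv {x y : WeakPerm n} : x ≤ y ↔ ∀ b a, x.Inv b a → y.Inv b a := by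
  constructor
  · intro h
    change Relation.ReflTransGen Step x y at h
    induction h with
    | refl => exact fun _ _ h => h
    | tail _ hs ih => exact fun b a h => inv_mono_of_step hs (ih b a h)
  · intro h
    change Relation.ReflTransGen Step x y
    classical
    obtain ⟨m, hm⟩ : ∃ m, m = (Finset.univ.filter
      fun p : Fin n × Fin n => y.Inv p.1 p.2 ∧ ¬ x.Inv p.1 p.2).card := ⟨_, rfl⟩
    induction m using Nat.strong_induction_on generalizing x with
    | _ m ih =>
      by_cases hxy : x = y
      · rw [hxy]
      · obtain ⟨z, hz, b, a, hxb, hyb, hzi⟩ := exists_step h hxy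
        refine Relation.ReflTransGen.head hz (ih _ ?_ ?_ rfl)
        · rw [hm]
          apply Finset.card_lt_card
          rw [Finset.ssubset_iff_of_subset]
          · exact ⟨(b, a), by simp [hxb, hyb], by simp [hzi]⟩
          · intro p
            simp only [Finset.mem_filter, Finset.mem_univ, true_and, hzi]
            tauto
        · intro d c hd
          rcases (hzi d c).1 hd with hd | ⟨rfl, rfl⟩
          · exact h _ _ hd
          · exact hyb

instance : PartialOrder (WeakPerm n) where
  le_refl _ := Relation.ReflTransGen.refl
  le_trans _ _ _ := Relation.ReflTransGen.trans
  le_antisymm _ _ h1 h2 := eq_of_inv_iff fun b a =>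
    ⟨le_iff_inv.1 h1 b a, le_iff_inv.1 h2 b a⟩

theorem inv_trans {x : WeakPerm n} {c b a : Fin n} (h1 : x.Inv c b) (h2 : x.Inv b a) :
    x.Inv c a :=
  ⟨h2.1.trans h1.1, h1.2.trans h2.2⟩

theorem inv_cotrans {x : WeakPerm n} {c b a : Fin n} (h : x.Inv c a) (h1 : a < b) (h2 : b < c) :
    x.Inv c b ∨ x.Inv b a := by
  by_cases hc : x.toPerm.symm c < x.toPerm.symm b
  · exact Or.inl ⟨h2, hc⟩
  · exact Or.inr ⟨h1, lt_of_le_of_lt (not_lt.1 hc) h.2⟩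

/-- A transitive and cotransitive set of pairs is the inversion set of a permutation. -/
theorem exists_inv_eq (T : Fin n → Fin n → Prop) (hlt : ∀ b a, T b a → a < b)
    (htr : ∀ c b a, T c b → T b a → T c a)
    (hco : ∀ c b a, T c a → a < b → b < c → T c b ∨ T b a) :
    ∃ x : WeakPerm n, ∀ b a, x.Inv b a ↔ T b a := by
  classical
  let r : Fin n → Fin n → Prop := fun v w => (v < w ∧ ¬ T w v) ∨ T v w
  have rirr : ∀ v, ¬ r v v := by
    rintro v (h | h)
    · exact lt_irrefl _ h.1
    · exact lt_irrefl _ (hlt _ _ h)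
  have rtri : ∀ v w, v ≠ w → r v w ∨ r w v := by
    intro v w h
    by_cases h1 : T v w
    · exact Or.inl (Or.inr h1)
    by_cases h2 : T w v
    · exact Or.inr (Or.inr h2)
    rcases lt_or_gt_of_ne h with h | h
    · exact Or.inl (Or.inl ⟨h, h2⟩)
    · exact Or.inr (Or.inl ⟨h, h1⟩)
  have rtrans : ∀ u v w, r u v → r v w → r u w := by
    rintro u v w (⟨h1, h1'⟩ | h1) (⟨h2, h2'⟩ | h2)
    · refine Or.inl ⟨h1.trans h2, fun h => ?_⟩
      rcases hco _ _ _ h h1 h2 with h | h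
      · exact h2' h
      · exact h1' h
    · by_cases hT : T u w
      · exact Or.inr hT
      have hvw := hlt _ _ h2
      rcases lt_trichotomy u w with h | rfl | h
      · exact Or.inl ⟨h, fun hc => h1' (htr _ _ _ h2 hc)⟩
      · exact absurd h2 h1'
      · rcases hco _ _ _ h2 h h1 with hc | hc
        · exact absurd hc h1'
        · exact absurd hc hT
    · by_cases hT : T u w
      · exact Or.inr hT
      rcases lt_trichotomy u w with h | rfl | h
      · exact Or.inl ⟨h, fun hc => h2' (htr _ _ _ hc h1)⟩
      · exact absurd h1 h2'
      · rcases hco _ _ _ h1 h2 h with hc | hc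
        · exact absurd hc hT
        · exact absurd hc h2'
    · exact Or.inr (htr _ _ _ h1 h2)
  let P : Fin n → Finset (Fin n) := fun v => Finset.univ.filter fun u => r u v
  have hP : ∀ v w, r v w → (P v).card < (P w).card := by
    intro v w h
    apply Finset.card_lt_card
    rw [Finset.ssubset_iff_of_subset]
    · exact ⟨v, by simpa [P] using h, by simpa [P] using rirr v⟩
    · intro u
      simp only [P, Finset.mem_filter, Finset.mem_univ, true_and]
      exact fun hu => rtrans _ _ _ hu h
  have hPn : ∀ v, (P v).card < n := by
    intro v
    have : (P v).card < (Finset.univ : Finset (Fin n)).card := by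
      apply Finset.card_lt_card
      rw [Finset.ssubset_iff_of_subset (Finset.subset_univ _)]
      exact ⟨v, Finset.mem_univ _, by simpa [P] using rirr v⟩
    simpa using this
  let f : Fin n → Fin n := fun v => ⟨(P v).card, hPn v⟩
  have hf : ∀ v w, r v w → f v < f w := hP
  have hinj : Function.Injective f := by
    intro v w h
    by_contra hne
    rcases rtri v w hne with hr | hr
    · exact (hf _ _ hr).ne h
    · exact (hf _ _ hr).ne h.symm
  let e : Fin n ≃ Fin n := Equiv.ofBijective f (Finite.injective_iff_bijective.1 hinj)
  refine ⟨⟨e.symm⟩, fun b a => ?_⟩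
  change a < b ∧ f b < f a ↔ _
  constructor
  · rintro ⟨h1, h2⟩
    by_contra hc
    exact lt_asymm h2 (hf a b (Or.inl ⟨h1, hc⟩))
  · exact fun h => ⟨hlt _ _ h, hf _ _ (Or.inr h)⟩

theorem exists_isLUB (x y : WeakPerm n) : ∃ z, IsLUB {x, y} z := by
  let A : Fin n → Fin n → Prop := fun b a => x.Inv b a ∨ y.Inv b a
  have hA : ∀ b a, A b a → a < b := fun b a h => h.elim (·.1) (·.1)
  have hTlt : ∀ b a, Relation.TransGen A b a → a < b := by
    intro b a h
    induction h with
    | single h => exact hA _ _ h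
    | tail _ h ih => exact (hA _ _ h).trans ih
  obtain ⟨z, hz⟩ := exists_inv_eq (Relation.TransGen A) hTlt (fun _ _ _ => Relation.TransGen.trans)
    (by
      intro c b a h
      induction h with
      | single h =>
        intro h1 h2
        rcases h with h | h
        · exact (inv_cotrans h h1 h2).imp (fun h => .single (Or.inl h)) fun h => .single (Or.inl h)
        · exact (inv_cotrans h h1 h2).imp (fun h => .single (Or.inr h)) fun h => .single (Or.inr h)
      | @tail d a hcd hda ih =>
        intro h1 h2
        rcases lt_trichotomy d b with h | rfl | h
        · exact (ih h h2).imp id fun h => h.tail hda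
        · exact Or.inl hcd
        · rcases hda with hd | hd
          · exact (inv_cotrans hd h1 h).imp (fun h => hcd.tail (Or.inl h)) fun h => .single (Or.inl h)
          · exact (inv_cotrans hd h1 h).imp (fun h => hcd.tail (Or.inr h)) fun h => .single (Or.inr h))
  refine ⟨z, ?_, ?_⟩
  · rintro w (rfl | rfl)
    · exact le_iff_inv.2 fun b a h => (hz b a).2 (.single (Or.inl h))
    · exact le_iff_inv.2 fun b a h => (hz b a).2 (.single (Or.inr h))
  · intro w hw
    have h1 := le_iff_inv.1 (hw (Set.mem_insert x {y}))
    have h2 := le_iff_inv.1 (hw (Set.mem_insert_of_mem x (Set.mem_singleton y)))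
    refine le_iff_inv.2 fun b a h => ?_
    have hAw : ∀ d c, A d c → w.Inv d c := fun d c h => Or.elim h (h1 d c) (h2 d c)
    have hT := (hz b a).1 h
    clear h
    induction hT with
    | single h => exact hAw _ _ h
    | tail _ h ih => exact inv_trans ih (hAw _ _ h)

/-- Reversing the one-line notation is an anti-automorphism of the weak order. -/
def rev (x : WeakPerm n) : WeakPerm n := ⟨Fin.revPerm.trans x.toPerm⟩

theorem rev_rev (x : WeakPerm n) : x.rev.rev = x := by
  ext k; simp [rev]

theorem inv_rev (x : WeakPerm n) (b a : Fin n) : x.rev.Inv b a ↔ a < b ∧ ¬ x.Inv b a := by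
  simp only [Inv, rev, Equiv.symm_trans_apply, Fin.revPerm_symm, Fin.revPerm_apply, Fin.rev_lt_rev]
  constructor
  · exact fun h => ⟨h.1, fun h' => lt_asymm h.2 h'.2⟩
  · rintro ⟨h, h'⟩
    refine ⟨h, lt_of_le_of_ne (not_lt.1 fun hc => h' ⟨h, hc⟩) fun e => ?_⟩
    exact h.ne (x.toPerm.symm.injective e)

theorem rev_le_rev {x y : WeakPerm n} (h : x ≤ y) : y.rev ≤ x.rev := by
  rw [le_iff_inv] at *
  intro b a hb
  rw [inv_rev] at *
  exact ⟨hb.1, fun hc => hb.2 (h _ _ hc)⟩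

theorem exists_isGLB (x y : WeakPerm n) : ∃ z, IsGLB {x, y} z := by
  obtain ⟨z, hz, hz'⟩ := exists_isLUB x.rev y.rev
  refine ⟨z.rev, ?_, ?_⟩
  · rintro w (rfl | rfl)
    · simpa [rev_rev] using rev_le_rev (hz (Set.mem_insert w.rev {y.rev}))
    · simpa [rev_rev] using
        rev_le_rev (hz (Set.mem_insert_of_mem x.rev (Set.mem_singleton w.rev)))
  · intro w hw
    have : z ≤ w.rev := by
      apply hz'
      rintro v (rfl | rfl)
      · exact rev_le_rev (hw (Set.mem_insert x {y}))
      · exact rev_le_rev (hw (Set.mem_insert_of_mem x (Set.mem_singleton y)))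
    simpa [rev_rev] using rev_le_rev this

/-- The weak order is a lattice. -/
noncomputable instance : Lattice (WeakPerm n) where
  sup x y := (exists_isLUB x y).choose
  le_sup_left x y := (exists_isLUB x y).choose_spec.1 (Set.mem_insert x {y})
  le_sup_right x y :=
    (exists_isLUB x y).choose_spec.1 (Set.mem_insert_of_mem x (Set.mem_singleton y))
  sup_le x y z h1 h2 := (exists_isLUB x y).choose_spec.2 (by rintro w (rfl | rfl) <;> assumption)
  inf x y := (exists_isGLB x y).choose
  inf_le_left x y := (exists_isGLB x y).choose_spec.1 (Set.mem_insert x {y})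
  inf_le_right x y :=
    (exists_isGLB x y).choose_spec.1 (Set.mem_insert_of_mem x (Set.mem_singleton y))
  le_inf x y z h1 h2 := (exists_isGLB y z).choose_spec.2 (by rintro w (rfl | rfl) <;> assumption)

/-- The set of positions `i` with `x_i > x_{i+1}`. -/
def descents (x : WeakPerm n) : Set (Fin n) :=
  {i | ∃ j : Fin n, (j : ℕ) = i + 1 ∧ x.toPerm j < x.toPerm i}

end WeakPerm

/-! ### Canonical join representations and contracted elements -/

/-- `x = ⋁ S` is the canonical join representation of `x`: it is irredundant, and whenever
`x = ⋁ T`, every element of `S` lies below some element of `T`. -/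
def IsCanonicalJoinRep {L : Type*} [Lattice L] (S : Set L) (x : L) : Prop :=
  IsLUB S x ∧ (∀ S', S' ⊂ S → ¬ IsLUB S' x) ∧ ∀ T, IsLUB T x → ∀ s ∈ S, ∃ t ∈ T, s ≤ t

/-- The elements of the canonical join representation of `x`. -/
def canonicalJoinands {L : Type*} [Lattice L] (x : L) : Set L :=
  {s | ∃ S, IsCanonicalJoinRep S x ∧ s ∈ S}

/-- `x` is contracted by the congruence `Θ` if it is congruent to some element strictly below it. -/
def LatticeCon.Contracts {L : Type*} [Lattice L] (Θ : LatticeCon L) (x : L) : Prop :=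
  ∃ y, y < x ∧ Θ.r x y

/-! ### Arcs and noncrossing arc diagrams -/

/-- An arc on `n` points on a vertical line, up to combinatorial equivalence: its lower and upper
endpoints, and the set of those points strictly between them that are to the left of the arc. -/
@[ext]
structure Arc (n : ℕ) where
  bot : Fin n
  top : Fin n
  bot_lt_top : bot < top
  left : Finset (Fin n)
  left_subset : left ⊆ Finset.Ioo bot top

namespace Arc

variable {n : ℕ}

/-- `α` is a subarc of `β`. -/
def IsSubarc (α β : Arc n) : Prop :=
  β.bot ≤ α.bot ∧ α.top ≤ β.top ∧ α.left = β.left ∩ Finset.Ioo α.bot α.top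

/-- The curve `{(f y, y) : bot ≤ y ≤ top}` in the plane, where point number `c` is placed
at `(0, c)`, is a representative of the arc `α`: it is monotone upwards, connects the endpoints of
`α`, and passes to the right of the points in `α.left` and to the left of the other points between
the endpoints. -/
def IsDrawing (α : Arc n) (f : ℝ → ℝ) : Prop :=
  ContinuousOn f (Set.Icc ((α.bot : ℕ) : ℝ) ((α.top : ℕ) : ℝ)) ∧
    f ((α.bot : ℕ) : ℝ) = 0 ∧ f ((α.top : ℕ) : ℝ) = 0 ∧
    ∀ c, α.bot < c → c < α.top →
      (c ∈ α.left → 0 < f ((c : ℕ) : ℝ)) ∧ (c ∉ α.left → f ((c : ℕ) : ℝ) < 0)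

/-- The set of arcs `E` is a noncrossing arc diagram (up to combinatorial equivalence): its arcs
can be drawn simultaneously so that no two of them intersect except possibly at their endpoints,
and no two of them share the same upper endpoint or the same lower endpoint. -/
def IsNoncrossingDiagram (E : Set (Arc n)) : Prop :=
  (∃ f : Arc n → ℝ → ℝ, (∀ α ∈ E, α.IsDrawing (f α)) ∧
    ∀ α ∈ E, ∀ β ∈ E, α ≠ β →
      ∀ y ∈ Set.Icc ((α.bot : ℕ) : ℝ) ((α.top : ℕ) : ℝ) ∩
          Set.Icc ((β.bot : ℕ) : ℝ) ((β.top : ℕ) : ℝ), f α y = f β y →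
        (y = ((α.bot : ℕ) : ℝ) ∨ y = ((α.top : ℕ) : ℝ)) ∧
        (y = ((β.bot : ℕ) : ℝ) ∨ y = ((β.top : ℕ) : ℝ))) ∧
  ∀ α ∈ E, ∀ β ∈ E, α ≠ β → α.bot ≠ β.bot ∧ α.top ≠ β.top

/-- The bijection between join-irreducible permutations `j` and arcs, as a relation: `α` connects
the two entries `j_i > j_{i+1}` forming the (unique) descent of `j`, and a value `c` strictly
between them is to the left of `α` if and only if `c` occurs in `j` to the left of the descent. -/
def Corresponds (j : WeakPerm n) (α : Arc n) : Prop :=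
  ∃ i i' : Fin n, (i' : ℕ) = i + 1 ∧ j.toPerm i = α.top ∧ j.toPerm i' = α.bot ∧
    ∀ c, α.bot < c → c < α.top → (c ∈ α.left ↔ j.toPerm.symm c < i)

end Arc

/-- The map `δ`, taking a permutation to the set of arcs corresponding to the elements of its
canonical join representation. -/
def arcDiagram {n : ℕ} (x : WeakPerm n) : Set (Arc n) :=
  {α | ∃ j ∈ canonicalJoinands x, Arc.Corresponds j α}

/-- The set of arcs corresponding to the join-irreducible permutations not contracted by `Θ`. -/
def uncontractedArcs {n : ℕ} (Θ : LatticeCon (WeakPerm n)) : Set (Arc n) :=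
  {α | ∃ j : WeakPerm n, SupIrred j ∧ ¬ Θ.Contracts j ∧ Arc.Corresponds j α}

/-! A permutation `x` has one arc for each of its descents, given by `Arc.Corresponds x`, and each
arc `α` has a permutation `α.perm`, whose inversions `(d, c)` have `d` at the top or to the left
of `α` and `c` at the bottom or to its right. The proof rests on the observation
(`Corresponds.perm_le`) that for an arc `α` of `x`, the elements below `x` that contain the
inversion of this descent are exactly those above `α.perm`. Hence the `α.perm` form the canonical
join representation of `x` (`isCanonicalJoinRep_perm_image`), the permutations `α.perm` are the
join-irreducible ones (`supIrred_iff`), and `arcDiagram x` is the set of arcs of the descents of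
`x` (`arcDiagram_eq`). In particular `arcDiagram` is injective and the number of arcs is the
number of descents.

The arcs of `x` do not cross: the graph of `x` with segments drawn along the descents becomes a
drawing of them after its points are moved horizontally to one line
(`Corresponds.isDrawing_curve`, `Corresponds.endpoints_of_curve_eq`). Conversely, by the
intermediate value theorem, of two noncrossing arcs one lies to the left of the other
(`IsNoncrossingDiagram.combNoncrossing`), and this is enough to see that in the join of the
permutations `α.perm` of a noncrossing diagram, the top and the bottom of each arc stay adjacent,
with the points to the left and to the right of the arc on the correct sides
(`CombNoncrossing.corresponds_iff_mem`). So every diagram occurs.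

A congruence leaves `x` uncontracted if and only if it contracts none of the arcs of `x`
(`not_contracts_iff`), so the diagrams of the uncontracted permutations are the diagrams
consisting of uncontracted arcs. If `α` is a subarc of `β`, there is a permutation `y` with
`β.perm ≤ α.perm ⊔ y` but not `β.perm ≤ y`, above everything strictly below `α.perm`; thus
contracting `α` forces contracting `β` (`mem_uncontractedArcs_of_isSubarc`). Finally, for `U`
closed under subarcs, lying above the same `α.perm` with `α ∈ U` is compatible with joins: by
induction on the length of `β`, the relation `β.perm ≤ x ⊔ z` either comes from `x` or `z` alone,
or is built from shorter subarcs of `β` below `x ⊔ z` (`perm_le_sup_of_forall`). This is the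
congruence with uncontracted arcs `U`. -/

/-! ### Adjacent entries and lower covers -/

namespace WeakPerm

variable {n : ℕ}

/-- A relation contained in `>` and cotransitive generates the inversion set of a permutation. -/
theorem exists_inv_iff_transGen (A : Fin n → Fin n → Prop) (hlt : ∀ b a, A b a → a < b)
    (hco : ∀ c b a, A c a → a < b → b < c → A c b ∨ A b a) :
    ∃ x : WeakPerm n, ∀ b a, x.Inv b a ↔ Relation.TransGen A b a := by
  refine exists_inv_eq (Relation.TransGen A) ?_ (fun _ _ _ => Relation.TransGen.trans) ?_
  · intro b a h
    induction h with
    | single h => exact hlt _ _ h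
    | tail _ h ih => exact (hlt _ _ h).trans ih
  · intro c b a h
    induction h with
    | single h => exact fun h1 h2 => (hco _ _ _ h h1 h2).imp .single .single
    | @tail d a hcd hda ih =>
      intro h1 h2
      rcases lt_trichotomy d b with h | rfl | h
      · exact (ih h h2).imp id fun h => h.tail hda
      · exact Or.inl hcd
      · exact (hco _ _ _ hda h1 h).imp hcd.tail .single

/-- An inversion of `x ⊔ y` that is not one of `x` or of `y` is composed of two shorter ones. -/
theorem inv_sup_cases {x y : WeakPerm n} {b a : Fin n} (h : (x ⊔ y).Inv b a) :
    x.Inv b a ∨ y.Inv b a ∨ ∃ c, (x ⊔ y).Inv b c ∧ (x ⊔ y).Inv c a := by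
  obtain ⟨z, hz⟩ := exists_inv_iff_transGen (fun b a => x.Inv b a ∨ y.Inv b a)
    (fun b a h => h.elim (·.1) (·.1)) (by
      rintro c b a (h | h) h1 h2
      · exact (inv_cotrans h h1 h2).imp Or.inl Or.inl
      · exact (inv_cotrans h h1 h2).imp Or.inr Or.inr)
  have hzs : x ⊔ y ≤ z := sup_le (le_iff_inv.2 fun b a h => (hz b a).2 (.single (Or.inl h)))
    (le_iff_inv.2 fun b a h => (hz b a).2 (.single (Or.inr h)))
  have key : ∀ d c, x.Inv d c ∨ y.Inv d c → (x ⊔ y).Inv d c := fun d c h =>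
    h.elim (le_iff_inv.1 le_sup_left d c) (le_iff_inv.1 le_sup_right d c)
  have hsz : ∀ d c, Relation.TransGen (fun b a => x.Inv b a ∨ y.Inv b a) d c →
      (x ⊔ y).Inv d c := by
    intro d c h
    induction h with
    | single h => exact key _ _ h
    | tail _ h ih => exact inv_trans ih (key _ _ h)
  have hT := (hz b a).1 (le_iff_inv.1 hzs b a h)
  cases hT with
  | single h => exact h.elim Or.inl fun h => Or.inr (Or.inl h)
  | tail h1 h2 => exact Or.inr (Or.inr ⟨_, hsz _ _ h1, key _ _ h2⟩)

theorem not_inv_iff {x : WeakPerm n} {b a : Fin n} (h : a < b) :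
    ¬ x.Inv b a ↔ x.toPerm.symm a < x.toPerm.symm b := by
  have hne : x.toPerm.symm a ≠ x.toPerm.symm b := fun e => h.ne (x.toPerm.symm.injective e)
  simp only [Inv, h, true_and, not_lt]
  exact ⟨fun h => lt_of_le_of_ne h hne, le_of_lt⟩

theorem inv_of_le {t x : WeakPerm n} (h : t ≤ x) {b a : Fin n} (hb : t.Inv b a) : x.Inv b a :=
  le_iff_inv.1 h b a hb

end WeakPerm

namespace Arc

variable {n : ℕ}

theorem corresponds_iff {x : WeakPerm n} {α : Arc n} :
    Corresponds x α ↔ (x.toPerm.symm α.bot : ℕ) = x.toPerm.symm α.top + 1 ∧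
      ∀ c, α.bot < c → c < α.top → (c ∈ α.left ↔ x.toPerm.symm c < x.toPerm.symm α.top) := by
  constructor
  · rintro ⟨i, i', h, hi, hi', hl⟩
    rw [← hi, ← hi'] at *
    simpa using ⟨h, hl⟩
  · rintro ⟨h, hl⟩
    exact ⟨_, _, h, by simp, by simp, hl⟩

theorem exists_corresponds {x : WeakPerm n} {i j : Fin n} (hij : (j : ℕ) = i + 1)
    (hlt : x.toPerm j < x.toPerm i) :
    ∃ α : Arc n, Corresponds x α ∧ α.top = x.toPerm i ∧ α.bot = x.toPerm j := by
  refine ⟨⟨x.toPerm j, x.toPerm i, hlt,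
    (Finset.Ioo (x.toPerm j) (x.toPerm i)).filter fun c => x.toPerm.symm c < i,
    Finset.filter_subset _ _⟩, ⟨i, j, hij, rfl, rfl, fun c h1 h2 => ?_⟩, rfl, rfl⟩
  have h1' : x.toPerm j < c := h1
  have h2' : c < x.toPerm i := h2
  simp [h1', h2']

theorem Corresponds.inv {x : WeakPerm n} {α : Arc n} (h : Corresponds x α) :
    x.Inv α.top α.bot :=
  ⟨α.bot_lt_top, by have := (corresponds_iff.1 h).1; rw [Fin.lt_def]; omega⟩

theorem Corresponds.eq_of_top {x : WeakPerm n} {α β : Arc n} (hα : Corresponds x α)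
    (hβ : Corresponds x β) (h : α.top = β.top) : α = β := by
  obtain ⟨h1, h2⟩ := corresponds_iff.1 hα
  obtain ⟨h3, h4⟩ := corresponds_iff.1 hβ
  have hb : α.bot = β.bot := x.toPerm.symm.injective (Fin.ext (by rw [h1, h3, h]))
  refine Arc.ext hb h ?_
  ext c
  by_cases hc : α.bot < c ∧ c < α.top
  · rw [h2 c hc.1 hc.2, h4 c (hb ▸ hc.1) (h ▸ hc.2), h]
  · refine iff_of_false (fun hm => hc ?_) (fun hm => hc ?_)
    · simpa using α.left_subset hm
    · simpa [hb, h] using β.left_subset hm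

theorem Corresponds.eq_of_bot {x : WeakPerm n} {α β : Arc n} (hα : Corresponds x α)
    (hβ : Corresponds x β) (h : α.bot = β.bot) : α = β := by
  refine hα.eq_of_top hβ (x.toPerm.symm.injective (Fin.ext ?_))
  have h1 := (corresponds_iff.1 hα).1
  have h2 := (corresponds_iff.1 hβ).1
  rw [h] at h1
  omega

/-- Undoing the descent of `x` corresponding to `α` gives a lower cover of `x`. -/
theorem Corresponds.exists_lower {x : WeakPerm n} {α : Arc n} (h : Corresponds x α) :
    ∃ y, y ≤ x ∧ ¬ y.Inv α.top α.bot ∧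
      ∀ d c, x.Inv d c ↔ y.Inv d c ∨ (d = α.top ∧ c = α.bot) := by
  obtain ⟨i, j, hij, hi, hj, -⟩ := h
  have hne : i ≠ j := by rintro rfl; omega
  let y : WeakPerm n := ⟨(Equiv.swap i j).trans x.toPerm⟩
  have yi : y.toPerm i = α.bot := by simp [y, hj]
  have yj : y.toPerm j = α.top := by simp [y, hi]
  have hinv : ∀ d c, x.Inv d c ↔ y.Inv d c ∨ (d = α.top ∧ c = α.bot) := by
    have := WeakPerm.inv_of_step (x := y) (y := x) i j hij (by rw [yi, yj]; exact α.bot_lt_top)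
      (by rw [yj, hi]) (by rw [yi, hj])
      (fun k h1 h2 => by simp [y, Equiv.swap_apply_of_ne_of_ne h1 h2])
    simpa only [yi, yj] using this
  refine ⟨y, WeakPerm.le_iff_inv.2 fun b a hb => (hinv b a).2 (Or.inl hb), fun hc => ?_, hinv⟩
  have := hc.2
  rw [← yi, ← yj, Equiv.symm_apply_apply, Equiv.symm_apply_apply, Fin.lt_def] at this
  omega

/-- Below `x`, an element other than `x` avoids the inversion of some descent of `x`. -/
theorem exists_corresponds_not_inv {z x : WeakPerm n} (h : z ≤ x) (hne : z ≠ x) :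
    ∃ α : Arc n, Corresponds x α ∧ ¬ z.Inv α.top α.bot := by
  have h' : Relation.ReflTransGen WeakPerm.Step z x := h
  rcases h'.cases_tail with rfl | ⟨y, hzy, i, j, hij, hlt, hi, hj, -⟩
  · exact absurd rfl hne
  obtain ⟨α, hα, ht, hb⟩ := exists_corresponds (x := x) hij (by rwa [hi, hj])
  refine ⟨α, hα, fun hc => ?_⟩
  have := (WeakPerm.le_iff_inv.1 (show z ≤ y from hzy) _ _ hc).2
  rw [ht, hb, hi, hj, Equiv.symm_apply_apply, Equiv.symm_apply_apply, Fin.lt_def] at this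
  omega

/-! ### The join-irreducible permutation of an arc -/

/-- The inversions of the join-irreducible permutation corresponding to `α`: the upper value is
the top of `α` or to its left, the lower value is the bottom of `α` or to its right. -/
def Pair (α : Arc n) (d c : Fin n) : Prop :=
  c < d ∧ (d ∈ α.left ∨ d = α.top) ∧ α.bot ≤ c ∧ c ∉ α.left

theorem mem_left {α : Arc n} {c : Fin n} (h : c ∈ α.left) : α.bot < c ∧ c < α.top := by
  simpa using α.left_subset h

theorem bot_notMem (α : Arc n) : α.bot ∉ α.left := fun h => (mem_left h).1.false

theorem top_notMem (α : Arc n) : α.top ∉ α.left := fun h => (mem_left h).2.false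

theorem Pair.le_top {α : Arc n} {d c : Fin n} (h : α.Pair d c) : d ≤ α.top :=
  h.2.1.elim (fun h => (mem_left h).2.le) le_of_eq

theorem pair_top_bot (α : Arc n) : α.Pair α.top α.bot :=
  ⟨α.bot_lt_top, Or.inr rfl, le_rfl, α.bot_notMem⟩

theorem Pair.cotrans {α : Arc n} {d e c : Fin n} (h : α.Pair d c) (h1 : c < e) (h2 : e < d) :
    α.Pair d e ∨ α.Pair e c := by
  by_cases he : e ∈ α.left
  · exact Or.inr ⟨h1, Or.inl he, h.2.2⟩
  · exact Or.inl ⟨h2, h.2.1, h.2.2.1.trans h1.le, he⟩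

theorem exists_inv_iff_pair (α : Arc n) : ∃ x : WeakPerm n, ∀ d c, x.Inv d c ↔ α.Pair d c := by
  refine WeakPerm.exists_inv_eq _ (fun _ _ h => h.1) ?_ (fun _ _ _ h h1 h2 => h.cotrans h1 h2)
  -- no value is both an upper and a lower value of a pair
  rintro d e c h1 h2
  rcases h2.2.1 with h | h
  · exact absurd h h1.2.2.2
  · exact absurd (h ▸ h1.1) (not_lt.2 h1.le_top)

/-- The join-irreducible permutation corresponding to the arc `α`. -/
noncomputable def perm (α : Arc n) : WeakPerm n := α.exists_inv_iff_pair.choose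

theorem inv_perm (α : Arc n) (d c : Fin n) : α.perm.Inv d c ↔ α.Pair d c :=
  α.exists_inv_iff_pair.choose_spec d c

theorem perm_le_iff {α : Arc n} {x : WeakPerm n} :
    α.perm ≤ x ↔ ∀ d c, α.Pair d c → x.Inv d c := by
  simp only [WeakPerm.le_iff_inv, inv_perm]

theorem inv_of_perm_le {α : Arc n} {x : WeakPerm n} (h : α.perm ≤ x) : x.Inv α.top α.bot :=
  perm_le_iff.1 h _ _ α.pair_top_bot

/-- A criterion for `α.perm ≤ x`: it suffices that the values to the left of `α` come before its
top, the top before its bottom, and the bottom before the values to the right. -/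
theorem perm_le_of_not_inv {α : Arc n} {x : WeakPerm n} (h : x.Inv α.top α.bot)
    (hl : ∀ c ∈ α.left, ¬ x.Inv α.top c)
    (hr : ∀ c, α.bot < c → c < α.top → c ∉ α.left → ¬ x.Inv c α.bot) : α.perm ≤ x := by
  refine perm_le_iff.2 fun d c hp => ⟨hp.1, ?_⟩
  have h1 : x.toPerm.symm d ≤ x.toPerm.symm α.top := by
    rcases hp.2.1 with hd | rfl
    · exact ((WeakPerm.not_inv_iff (mem_left hd).2).1 (hl d hd)).le
    · exact le_rfl
  have h2 : x.toPerm.symm α.bot ≤ x.toPerm.symm c := by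
    rcases hp.2.2.1.lt_or_eq with hc | rfl
    · exact ((WeakPerm.not_inv_iff hc).1 (hr c hc (hp.1.trans_le hp.le_top) hp.2.2.2)).le
    · exact le_rfl
  exact h1.trans_lt (h.2.trans_le h2)

/-- Among the elements below `x`, those above `α.perm` are the ones containing the inversion of the
descent of `x` corresponding to `α`. -/
theorem Corresponds.perm_le {x t : WeakPerm n} {α : Arc n} (h : Corresponds x α) (ht : t ≤ x)
    (hi : t.Inv α.top α.bot) : α.perm ≤ t := by
  obtain ⟨h1, h2⟩ := corresponds_iff.1 h
  refine perm_le_of_not_inv hi (fun c hc hinv => ?_) (fun c hb htop hc hinv => ?_)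
  · have := (mem_left hc)
    exact lt_asymm ((h2 c this.1 this.2).1 hc) (WeakPerm.inv_of_le ht hinv).2
  · have h3 := (WeakPerm.inv_of_le ht hinv).2
    have h4 := mt (h2 c hb htop).2 hc
    have h5 : x.toPerm.symm c ≠ x.toPerm.symm α.top := fun e =>
      htop.ne (x.toPerm.symm.injective e)
    rw [Fin.lt_def] at h3 h4
    rw [Ne, Fin.ext_iff] at h5
    omega

theorem Corresponds.perm_le_self {x : WeakPerm n} {α : Arc n} (h : Corresponds x α) :
    α.perm ≤ x := h.perm_le le_rfl h.inv

/-! ### Noncrossing arcs, combinatorially -/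

/-- The side of `α` on which the curve passes a point `c` of its range: `1` if `c` is to the left of
`α`, `-1` if it is to the right, and `0` if `c` is an endpoint. -/
def side (α : Arc n) (c : Fin n) : ℤ :=
  if c ∈ α.left then 1 else if c = α.bot ∨ c = α.top then 0 else -1

/-- `α` is weakly to the left of `β` at all points in the common range of `α` and `β`. -/
def LeftOf (α β : Arc n) : Prop :=
  ∀ c, α.bot ≤ c → c ≤ α.top → β.bot ≤ c → c ≤ β.top → α.side c ≤ β.side c

/-- The combinatorial form of the noncrossing condition on a set of arcs. -/
def CombNoncrossing (E : Set (Arc n)) : Prop :=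
  ∀ α ∈ E, ∀ β ∈ E, α ≠ β →
    α.bot ≠ β.bot ∧ α.top ≠ β.top ∧ (α.LeftOf β ∨ β.LeftOf α)

theorem side_bot (α : Arc n) : α.side α.bot = 0 := by simp [side, bot_notMem]

theorem side_top (α : Arc n) : α.side α.top = 0 := by simp [side, top_notMem]

theorem side_eq_one {α : Arc n} {c : Fin n} : α.side c = 1 ↔ c ∈ α.left := by
  unfold side; split_ifs <;> simp_all

theorem side_eq_zero {α : Arc n} {c : Fin n} : α.side c = 0 ↔ c = α.bot ∨ c = α.top := by
  unfold side
  split_ifs with h1 h2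
  · have := mem_left h1
    simp [this.1.ne', this.2.ne]
  · simpa using h2
  · simpa using h2

theorem side_le_one (α : Arc n) (c : Fin n) : α.side c ≤ 1 := by
  unfold side; split_ifs <;> simp

theorem Pair.side_nonneg {α : Arc n} {d c : Fin n} (h : α.Pair d c) : 0 ≤ α.side d := by
  rcases h.2.1 with h | rfl
  · rw [side_eq_one.2 h]; simp
  · rw [side_top]

theorem Pair.side_nonpos {α : Arc n} {d c : Fin n} (h : α.Pair d c) : α.side c ≤ 0 := by
  have := mt side_eq_one.1 h.2.2.2
  have := α.side_le_one c
  omega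

/-- Within the range of `α`, the inversions of the arcs of the diagram do not lead down from an
endpoint or the right of `α` to its left. -/
theorem CombNoncrossing.side_nonpos {E : Set (Arc n)} (hE : CombNoncrossing E) {α β : Arc n}
    (hα : α ∈ E) (hβ : β ∈ E) {d c : Fin n} (h : β.Pair d c) (hc : α.bot ≤ c) (hd : d ≤ α.top)
    (hs : α.side d ≤ 0) : α.side c ≤ 0 := by
  by_contra hpos
  have hne : α ≠ β := by rintro rfl; exact hpos h.side_nonpos
  have hnn := h.side_nonneg
  have hnp := h.side_nonpos
  obtain ⟨-, htop, hl | hl⟩ := hE α hα β hβ hne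
  · have := hl c hc (h.1.le.trans hd) h.2.2.1 (h.1.le.trans h.le_top)
    omega
  · have := hl d (h.2.2.1.trans h.1.le) h.le_top (hc.trans h.1.le) hd
    have e1 := side_eq_zero.1 (show α.side d = 0 by omega)
    have e2 := side_eq_zero.1 (show β.side d = 0 by omega)
    exact htop ((e1.resolve_left (hc.trans_lt h.1).ne').symm.trans
      (e2.resolve_left (h.2.2.1.trans_lt h.1).ne'))

/-- Within the range of `α`, the inversions of the arcs of the diagram do not lead down from the
right of `α` to an endpoint or its left. -/
theorem CombNoncrossing.side_nonneg {E : Set (Arc n)} (hE : CombNoncrossing E) {α β : Arc n}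
    (hα : α ∈ E) (hβ : β ∈ E) {d c : Fin n} (h : β.Pair d c) (hc : α.bot ≤ c) (hd : d ≤ α.top)
    (hs : 0 ≤ α.side c) : 0 ≤ α.side d := by
  by_contra hneg
  have hne : α ≠ β := by rintro rfl; exact hneg h.side_nonneg
  have hnn := h.side_nonneg
  have hnp := h.side_nonpos
  obtain ⟨hbot, -, hl | hl⟩ := hE α hα β hβ hne
  · have := hl c hc (h.1.le.trans hd) h.2.2.1 (h.1.le.trans h.le_top)
    have e1 := side_eq_zero.1 (show α.side c = 0 by omega)
    have e2 := side_eq_zero.1 (show β.side c = 0 by omega)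
    exact hbot ((e1.resolve_right (h.1.trans_le hd).ne).symm.trans
      (e2.resolve_right (h.1.trans_le h.le_top).ne))
  · have := hl d (h.2.2.1.trans h.1.le) h.le_top (hc.trans h.1.le) hd
    omega

end Arc

namespace Arc

variable {n : ℕ}

/-- The inversion of one descent of `x` does not occur in the join-irreducible permutation of
another one. -/
theorem Corresponds.eq_of_pair {x : WeakPerm n} {α β : Arc n} (hα : Corresponds x α)
    (hβ : Corresponds x β) (h : β.Pair α.top α.bot) : α = β := by
  by_cases ht : α.top = β.top
  · exact hα.eq_of_top hβ ht
  exfalso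
  obtain ⟨h1, -⟩ := corresponds_iff.1 hα
  obtain ⟨h3, h4⟩ := corresponds_iff.1 hβ
  have hl := h.2.1.resolve_right ht
  have h5 := (h4 _ (mem_left hl).1 (mem_left hl).2).1 hl
  rw [Fin.lt_def] at h5
  rcases h.2.2.1.lt_or_eq with hb | hb
  · have h7 := mt (h4 _ hb (h.1.trans_le h.le_top)).2 h.2.2.2
    rw [Fin.lt_def] at h7
    have h8 : α.bot = β.top := x.toPerm.symm.injective (Fin.ext (by omega))
    exact lt_asymm α.bot_lt_top (h8 ▸ (mem_left hl).2)
  · rw [hb] at h3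
    omega

/-! ### From noncrossing arcs to permutations -/

section Generated

variable {E : Set (Arc n)} {x : WeakPerm n}

theorem CombNoncrossing.side_nonpos_of_inv (hE : CombNoncrossing E)
    (hx : ∀ d c, x.Inv d c ↔ Relation.TransGen (fun d c => ∃ β ∈ E, β.Pair d c) d c)
    {α : Arc n} (hα : α ∈ E) {d c : Fin n} (h : x.Inv d c) (hc : α.bot ≤ c) (hd : d ≤ α.top)
    (hs : α.side d ≤ 0) : α.side c ≤ 0 := by
  have hT := (hx _ _).1 h
  clear h
  induction hT with
  | single h =>
    obtain ⟨β, hβ, hp⟩ := h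
    exact hE.side_nonpos hα hβ hp hc hd hs
  | tail h1 h2 ih =>
    obtain ⟨β, hβ, hp⟩ := h2
    exact hE.side_nonpos hα hβ hp hc (((hx _ _).2 h1).1.le.trans hd) (ih (hc.trans hp.1.le))

theorem CombNoncrossing.side_nonneg_of_inv (hE : CombNoncrossing E)
    (hx : ∀ d c, x.Inv d c ↔ Relation.TransGen (fun d c => ∃ β ∈ E, β.Pair d c) d c)
    {α : Arc n} (hα : α ∈ E) {d c : Fin n} (h : x.Inv d c) (hc : α.bot ≤ c) (hd : d ≤ α.top)
    (hs : 0 ≤ α.side c) : 0 ≤ α.side d := by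
  have hT := (hx _ _).1 h
  clear h
  induction hT using Relation.TransGen.head_induction_on with
  | single h =>
    obtain ⟨β, hβ, hp⟩ := h
    exact hE.side_nonneg hα hβ hp hc hd hs
  | head h1 h2 ih =>
    obtain ⟨β, hβ, hp⟩ := h1
    exact hE.side_nonneg hα hβ hp (hc.trans ((hx _ _).2 h2).1.le) hd (ih (hp.1.le.trans hd))

/-- An inversion of an arc of the diagram jumping over the top of `α` can be stopped there. -/
theorem CombNoncrossing.pair_top (hE : CombNoncrossing E) {α β : Arc n} (hα : α ∈ E) (hβ : β ∈ E)
    {d c : Fin n} (h : β.Pair d c) (hd : α.top < d) (hc : α.bot ≤ c) (hct : c < α.top)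
    (hs : 0 ≤ α.side c) : β.Pair d α.top := by
  refine (h.cotrans hct hd).resolve_right fun h' => ?_
  have hlt : α.top < β.top := hd.trans_le h.le_top
  have hne : α ≠ β := by rintro rfl; exact hlt.false
  have h1 := side_eq_one.2 (h'.2.1.resolve_right hlt.ne)
  obtain ⟨hbot, -, hl | hl⟩ := hE α hα β hβ hne
  · have h2 := hl c hc hct.le h.2.2.1 (h.1.le.trans h.le_top)
    have h3 := h.side_nonpos
    have e1 := side_eq_zero.1 (show α.side c = 0 by omega)
    have e2 := side_eq_zero.1 (show β.side c = 0 by omega)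
    exact hbot ((e1.resolve_right hct.ne).symm.trans (e2.resolve_right (hct.trans hlt).ne))
  · have h2 := hl α.top (h.2.2.1.trans hct.le) hlt.le α.bot_lt_top.le le_rfl
    rw [side_top] at h2
    omega

/-- An inversion of an arc of the diagram jumping over the bottom of `α` can be started there. -/
theorem CombNoncrossing.pair_bot (hE : CombNoncrossing E) {α β : Arc n} (hα : α ∈ E) (hβ : β ∈ E)
    {d c : Fin n} (h : β.Pair d c) (hc : c < α.bot) (hd : d ≤ α.top) (hdb : α.bot < d)
    (hs : α.side d ≤ 0) : β.Pair α.bot c := by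
  refine (h.cotrans hc hdb).resolve_left fun h' => ?_
  have hlt : β.bot < α.bot := h.2.2.1.trans_lt hc
  have hne : α ≠ β := by rintro rfl; exact hlt.false
  have h1 : β.side α.bot < 0 := by
    refine lt_of_le_of_ne h'.side_nonpos fun e => ?_
    rcases side_eq_zero.1 e with e | e
    · exact hlt.ne' e
    · exact (hdb.trans_le h.le_top).ne e
  obtain ⟨-, htop, hl | hl⟩ := hE α hα β hβ hne
  · have h2 := hl α.bot le_rfl α.bot_lt_top.le hlt.le (hdb.le.trans h.le_top)
    rw [side_bot] at h2
    omega
  · have h2 := hl d (hlt.le.trans hdb.le) h.le_top hdb.le hd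
    have h3 := h.side_nonneg
    have e1 := side_eq_zero.1 (show α.side d = 0 by omega)
    have e2 := side_eq_zero.1 (show β.side d = 0 by omega)
    exact htop ((e1.resolve_left hdb.ne').symm.trans (e2.resolve_left (hlt.trans hdb).ne'))

theorem CombNoncrossing.inv_top (hE : CombNoncrossing E)
    (hx : ∀ d c, x.Inv d c ↔ Relation.TransGen (fun d c => ∃ β ∈ E, β.Pair d c) d c)
    {α : Arc n} (hα : α ∈ E) {d c : Fin n} (h : x.Inv d c) (hd : α.top < d) (hc : α.bot ≤ c)
    (hct : c < α.top) (hs : 0 ≤ α.side c) : x.Inv d α.top := by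
  have hT := (hx _ _).1 h
  clear h
  induction hT with
  | single h =>
    obtain ⟨β, hβ, hp⟩ := h
    exact (hx _ _).2 (.single ⟨β, hβ, hE.pair_top hα hβ hp hd hc hct hs⟩)
  | @tail e c h1 h2 ih =>
    obtain ⟨β, hβ, hp⟩ := h2
    rcases lt_trichotomy e α.top with he | he | he
    · exact ih (hc.trans hp.1.le) he (hE.side_nonneg hα hβ hp hc he.le hs)
    · exact (hx _ _).2 (he ▸ h1)
    · exact (hx _ _).2 (h1.tail ⟨β, hβ, hE.pair_top hα hβ hp he hc hct hs⟩)

theorem CombNoncrossing.inv_bot (hE : CombNoncrossing E)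
    (hx : ∀ d c, x.Inv d c ↔ Relation.TransGen (fun d c => ∃ β ∈ E, β.Pair d c) d c)
    {α : Arc n} (hα : α ∈ E) {d c : Fin n} (h : x.Inv d c) (hc : c < α.bot) (hd : d ≤ α.top)
    (hdb : α.bot < d) (hs : α.side d ≤ 0) : x.Inv α.bot c := by
  have hT := (hx _ _).1 h
  clear h
  induction hT using Relation.TransGen.head_induction_on with
  | single h =>
    obtain ⟨β, hβ, hp⟩ := h
    exact (hx _ _).2 (.single ⟨β, hβ, hE.pair_bot hα hβ hp hc hd hdb hs⟩)
  | @head d e h1 h2 ih =>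
    obtain ⟨β, hβ, hp⟩ := h1
    rcases lt_trichotomy e α.bot with he | he | he
    · exact (hx _ _).2 (.head ⟨β, hβ, hE.pair_bot hα hβ hp he hd hdb hs⟩ h2)
    · exact (hx _ _).2 (he ▸ h2)
    · exact ih (hp.1.le.trans hd) he (hE.side_nonpos hα hβ hp he.le hd hs)

/-- The permutation generated by the inversions of noncrossing arcs has exactly these arcs. -/
theorem CombNoncrossing.corresponds_iff_mem (hE : CombNoncrossing E)
    (hx : ∀ d c, x.Inv d c ↔ Relation.TransGen (fun d c => ∃ β ∈ E, β.Pair d c) d c)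
    {α : Arc n} : Corresponds x α ↔ α ∈ E := by
  have mem : ∀ α ∈ E, Corresponds x α := by
    intro α hα
    have htb : x.Inv α.top α.bot := (hx _ _).2 (.single ⟨α, hα, α.pair_top_bot⟩)
    have hl : ∀ c, α.bot < c → c < α.top → x.Inv α.top c → c ∉ α.left := by
      intro c h1 h2 h hc
      have := hE.side_nonpos_of_inv hx hα h h1.le le_rfl (side_top α).le
      rw [side_eq_one.2 hc] at this
      omega
    have hr : ∀ c, α.bot < c → c < α.top → x.Inv c α.bot → c ∈ α.left := by
      intro c h1 h2 h
      by_contra hc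
      have h3 := hE.side_nonneg_of_inv hx hα h le_rfl h2.le (side_bot α).ge
      have h4 := α.side_le_one c
      have h5 := mt side_eq_one.1 hc
      rcases side_eq_zero.1 (show α.side c = 0 by omega) with e | e
      · exact h1.ne' e
      · exact h2.ne e
    refine corresponds_iff.2 ⟨?_, fun c h1 h2 => ⟨fun hc => ?_, fun hc => ?_⟩⟩
    · by_contra hadj
      have hlt := htb.2
      rw [Fin.lt_def] at hlt
      -- the entry right after the top of `α`
      obtain ⟨e, he⟩ := x.toPerm.symm.surjective
        ⟨x.toPerm.symm α.top + 1, by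
          have := (x.toPerm.symm α.bot).is_lt
          omega⟩
      have h1 : x.toPerm.symm α.top < x.toPerm.symm e := by rw [he, Fin.lt_def]; simp
      have h2 : x.toPerm.symm e < x.toPerm.symm α.bot := by
        rw [he, Fin.lt_def]; simp only; omega
      rcases lt_trichotomy e α.top with h3 | rfl | h3
      · rcases lt_trichotomy e α.bot with h4 | rfl | h4
        · exact lt_asymm h2
            (hE.inv_bot hx hα ⟨h3, h1⟩ h4 le_rfl α.bot_lt_top (side_top α).le).2
        · exact h2.false
        · exact hl e h4 h3 ⟨h3, h1⟩ (hr e h4 h3 ⟨h4, h2⟩)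
      · exact h1.false
      · exact lt_asymm h1 (hE.inv_top hx hα ⟨α.bot_lt_top.trans h3, h2⟩ h3 le_rfl
          α.bot_lt_top (side_bot α).ge).2
    · exact (WeakPerm.not_inv_iff h2).1 fun h => hl c h1 h2 h hc
    · exact hr c h1 h2 ⟨h1, hc.trans htb.2⟩
  refine ⟨fun h => ?_, mem α⟩
  have hT := (hx _ _).1 h.inv
  cases hT with
  | single h' =>
    obtain ⟨β, hβ, hp⟩ := h'
    rwa [h.eq_of_pair (mem β hβ) hp]
  | @tail e _ h1 h2 =>
    -- the two entries of a descent are adjacent, so their inversion is not composed of others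
    have h3 := ((hx _ _).2 h1).2
    have h4 := ((hx _ _).2 (.single h2)).2
    have h5 := (corresponds_iff.1 h).1
    rw [Fin.lt_def] at h3 h4
    omega

end Generated

/-- Every combinatorially noncrossing set of arcs is the set of arcs of some permutation. -/
theorem CombNoncrossing.exists_corresponds_iff {E : Set (Arc n)} (hE : CombNoncrossing E) :
    ∃ x : WeakPerm n, ∀ α, Corresponds x α ↔ α ∈ E := by
  obtain ⟨x, hx⟩ := WeakPerm.exists_inv_iff_transGen (fun d c => ∃ β ∈ E, β.Pair d c)
    (fun _ _ ⟨_, _, h⟩ => h.1) (fun d e c ⟨β, hβ, h⟩ h1 h2 =>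
      (h.cotrans h1 h2).imp (fun h => ⟨β, hβ, h⟩) fun h => ⟨β, hβ, h⟩)
  exact ⟨x, fun α => hE.corresponds_iff_mem hx⟩

theorem corresponds_perm_iff {α β : Arc n} : Corresponds α.perm β ↔ β = α := by
  have hE : CombNoncrossing {α} := by
    rintro _ rfl _ rfl h
    exact absurd rfl h
  refine hE.corresponds_iff_mem fun d c => ?_
  simp only [Set.mem_singleton_iff, exists_eq_left, ← inv_perm]
  constructor
  · exact .single
  · intro h
    induction h with
    | single h => exact h
    | tail _ h ih => exact WeakPerm.inv_trans ih h

theorem corresponds_perm (α : Arc n) : Corresponds α.perm α := corresponds_perm_iff.2 rfl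

theorem perm_injective : Function.Injective (perm : Arc n → WeakPerm n) := fun _ _ h =>
  corresponds_perm_iff.1 (h ▸ corresponds_perm _)

/-! ### Canonical join representations and join-irreducible permutations -/

/-- A permutation is the join of the join-irreducible permutations of its descents. -/
theorem isLUB_perm_image (x : WeakPerm n) : IsLUB (perm '' {α | Corresponds x α}) x := by
  refine ⟨?_, fun w hw => ?_⟩
  · rintro _ ⟨α, hα, rfl⟩
    exact Corresponds.perm_le_self hα
  · by_contra hc
    obtain ⟨α, hα, hn⟩ := exists_corresponds_not_inv (inf_le_left : x ⊓ w ≤ x)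
      (fun e => hc (inf_eq_left.1 e))
    exact hn (inv_of_perm_le (le_inf hα.perm_le_self (hw ⟨α, hα, rfl⟩)))

theorem Corresponds.exists_perm_le {x : WeakPerm n} {α : Arc n} (h : Corresponds x α)
    {T : Set (WeakPerm n)} (hT : IsLUB T x) : ∃ t ∈ T, α.perm ≤ t := by
  obtain ⟨y, hyx, hy, hinv⟩ := h.exists_lower
  by_contra! hc
  refine hy (WeakPerm.inv_of_le (hT.2 fun t ht => ?_) h.inv)
  refine WeakPerm.le_iff_inv.2 fun d c hd => ?_
  refine ((hinv d c).1 (WeakPerm.inv_of_le (hT.1 ht) hd)).resolve_right ?_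
  rintro ⟨rfl, rfl⟩
  exact hc t ht (h.perm_le (hT.1 ht) hd)

theorem isCanonicalJoinRep_perm_image (x : WeakPerm n) :
    IsCanonicalJoinRep (perm '' {α | Corresponds x α}) x := by
  refine ⟨isLUB_perm_image x, fun S' hS' hlub => ?_, ?_⟩
  · obtain ⟨_, ⟨α, hα, rfl⟩, hn⟩ := Set.exists_of_ssubset hS'
    obtain ⟨t, ht, hle⟩ := Corresponds.exists_perm_le hα hlub
    obtain ⟨β, hβ, rfl⟩ := hS'.1 ht
    have := Corresponds.eq_of_pair hα hβ ((inv_perm _ _ _).1 (inv_of_perm_le hle))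
    exact hn (this ▸ ht)
  · rintro T hT _ ⟨α, hα, rfl⟩
    exact Corresponds.exists_perm_le hα hT

end Arc

theorem IsCanonicalJoinRep.subset {L : Type*} [Lattice L] {S S' : Set L} {x : L}
    (h : IsCanonicalJoinRep S x) (h' : IsCanonicalJoinRep S' x) : S ⊆ S' := by
  intro s hs
  obtain ⟨t, ht, hst⟩ := h.2.2 S' h'.1 s hs
  obtain ⟨s', hs', hts'⟩ := h'.2.2 S h.1 t ht
  -- an irredundant set is an antichain
  have hss : s = s' := by
    by_contra hne
    refine h.2.1 (S \ {s}) (Set.sdiff_singleton_ssubset.2 hs)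
      ⟨fun u hu => h.1.1 hu.1, fun w hw => h.1.2 fun u hu => ?_⟩
    by_cases hus : u = s
    · rw [hus]
      exact (hst.trans hts').trans (hw ⟨hs', fun e => hne e.symm⟩)
    · exact hw ⟨hu, hus⟩
  rwa [le_antisymm hst (hss ▸ hts')]

theorem canonicalJoinands_eq {n : ℕ} (x : WeakPerm n) :
    canonicalJoinands x = Arc.perm '' {α | Arc.Corresponds x α} := by
  ext s
  constructor
  · rintro ⟨S, hS, hs⟩
    exact hS.subset (Arc.isCanonicalJoinRep_perm_image x) hs
  · exact fun hs => ⟨_, Arc.isCanonicalJoinRep_perm_image x, hs⟩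

theorem arcDiagram_eq {n : ℕ} (x : WeakPerm n) : arcDiagram x = {α | Arc.Corresponds x α} := by
  ext α
  simp only [arcDiagram, canonicalJoinands_eq, Set.mem_ofPred_eq, Set.exists_mem_image,
    Arc.corresponds_perm_iff]
  exact ⟨fun ⟨β, hβ, h⟩ => h ▸ hβ, fun h => ⟨α, h, rfl⟩⟩

theorem arcDiagram_injective {n : ℕ} : Function.Injective (arcDiagram (n := n)) := by
  intro x y h
  rw [arcDiagram_eq, arcDiagram_eq] at h
  exact (Arc.isLUB_perm_image x).unique (h ▸ Arc.isLUB_perm_image y)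

namespace Arc

variable {n : ℕ}

theorem supIrred_iff {j : WeakPerm n} : SupIrred j ↔ ∃ α : Arc n, j = α.perm := by
  constructor
  · rintro ⟨hmin, hj⟩
    obtain ⟨z, hz⟩ : ∃ z, z < j := by simpa [IsMin, lt_iff_le_not_ge] using hmin
    obtain ⟨α, hα, -⟩ := exists_corresponds_not_inv hz.le hz.ne
    obtain ⟨y, hyx, hy, hinv⟩ := hα.exists_lower
    have hsup : y ⊔ α.perm = j := by
      refine le_antisymm (sup_le hyx hα.perm_le_self) (WeakPerm.le_iff_inv.2 fun d c h => ?_)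
      rcases (hinv d c).1 h with h | ⟨rfl, rfl⟩
      · exact WeakPerm.inv_of_le le_sup_left h
      · exact inv_of_perm_le le_sup_right
    rcases hj hsup with h | h
    · exact absurd (h ▸ hα.inv) hy
    · exact ⟨α, h.symm⟩
  · rintro ⟨α, rfl⟩
    have hα := corresponds_perm α
    refine ⟨fun hmin => ?_, fun u v huv => ?_⟩
    · obtain ⟨y, hyx, hy, -⟩ := hα.exists_lower
      exact hy (WeakPerm.inv_of_le (hmin hyx) hα.inv)
    · have hlub : IsLUB {u, v} α.perm := huv ▸ isLUB_pair
      obtain ⟨t, ht, hle⟩ := hα.exists_perm_le hlub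
      rcases ht with rfl | rfl
      · exact Or.inl ((hlub.1 (by simp)).antisymm hle)
      · exact Or.inr ((hlub.1 (by simp)).antisymm hle)

theorem mem_uncontractedArcs {Θ : LatticeCon (WeakPerm n)} {α : Arc n} :
    α ∈ uncontractedArcs Θ ↔ ¬ Θ.Contracts α.perm := by
  constructor
  · rintro ⟨j, hj, hc, hcorr⟩
    obtain ⟨β, rfl⟩ := supIrred_iff.1 hj
    rwa [corresponds_perm_iff.1 hcorr]
  · exact fun h => ⟨_, supIrred_iff.2 ⟨α, rfl⟩, h, corresponds_perm α⟩

end Arc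

/-! ### Uncontracted arcs of a congruence -/

namespace Arc

variable {n : ℕ}

/-- Contraction of a permutation is decided by the arcs of its descents. -/
theorem not_contracts_iff {Θ : LatticeCon (WeakPerm n)} {x : WeakPerm n} :
    ¬ Θ.Contracts x ↔ ∀ α, Corresponds x α → α ∈ uncontractedArcs Θ := by
  simp only [mem_uncontractedArcs]
  refine ⟨?_, ?_⟩
  · rintro h α hα ⟨w, hw, hr⟩
    obtain ⟨y, hyx, hy, hinv⟩ := hα.exists_lower
    have hwx : w ≤ x := hw.le.trans hα.perm_le_self
    have hwy : w ≤ y := by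
      refine WeakPerm.le_iff_inv.2 fun d c hd => ?_
      refine ((hinv d c).1 (WeakPerm.inv_of_le hwx hd)).resolve_right ?_
      rintro ⟨rfl, rfl⟩
      exact hw.not_ge (hα.perm_le hwx hd)
    have hsup : y ⊔ α.perm = x := by
      refine le_antisymm (sup_le hyx hα.perm_le_self) (WeakPerm.le_iff_inv.2 fun d c h => ?_)
      rcases (hinv d c).1 h with h | ⟨rfl, rfl⟩
      · exact WeakPerm.inv_of_le le_sup_left h
      · exact inv_of_perm_le le_sup_right
    refine h ⟨y, lt_of_le_of_ne hyx fun e => hy (e ▸ hα.inv), ?_⟩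
    have := Θ.sup (Θ.refl y) hr
    rwa [hsup, sup_eq_left.2 hwy] at this
  · rintro h ⟨z, hz, hr⟩
    obtain ⟨α, hα, hn⟩ := exists_corresponds_not_inv hz.le hz.ne
    refine h α hα ⟨α.perm ⊓ z, ?_, ?_⟩
    · refine lt_of_le_of_ne inf_le_left fun e => hn (inv_of_perm_le (inf_eq_left.1 e))
    · have := Θ.inf (Θ.refl α.perm) hr
      rwa [inf_eq_left.2 hα.perm_le_self] at this

/-- The permutation in question lists the fibres of `f` in increasing order of `f`, each one
decreasingly. -/
theorem exists_inv_iff_le (f : Fin n → ℕ) :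
    ∃ x : WeakPerm n, ∀ d c, x.Inv d c ↔ c < d ∧ f d ≤ f c := by
  refine WeakPerm.exists_inv_eq _ (fun _ _ h => h.1) ?_ ?_
  · exact fun d e c h1 h2 => ⟨h2.1.trans h1.1, h1.2.trans h2.2⟩
  · intro d e c h h1 h2
    rcases le_total (f d) (f e) with h3 | h3
    · exact Or.inl ⟨h2, h3⟩
    · exact Or.inr ⟨h1, h3.trans h.2⟩

/-- A congruence contracting an arc contracts all arcs of which it is a subarc. -/
theorem mem_uncontractedArcs_of_isSubarc {Θ : LatticeCon (WeakPerm n)} {α β : Arc n}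
    (hβ : β ∈ uncontractedArcs Θ) (h : α.IsSubarc β) : α ∈ uncontractedArcs Θ := by
  rw [mem_uncontractedArcs] at *
  rintro ⟨v, hv, hr⟩
  obtain ⟨hbot, htop, hleft⟩ := h
  have hαt := α.bot_lt_top
  have hmem : ∀ c, α.bot < c → c < α.top → (c ∈ α.left ↔ c ∈ β.left) := by
    intro c h1 h2; simp [hleft, h1, h2]
  have hαl := fun c => mem_left (α := α) (c := c)
  have hβl := fun c => mem_left (α := β) (c := c)
  -- `y` reads: the left of `β`, the two bottoms, the two tops, the rest; so that the inversion of
  -- the tops with the bottoms is missing from `y`, and is supplied by `α.perm`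
  obtain ⟨y, hy⟩ := exists_inv_iff_le (n := n) fun c =>
    if c = α.bot ∨ c = β.bot then 1 else if c = α.top ∨ c = β.top then 2
    else if c ∈ β.left then 0 else 3
  have hvn : ¬ v.Inv α.top α.bot := fun hc =>
    hv.not_ge ((corresponds_perm α).perm_le hv.le hc)
  have hvy : v ≤ y := by
    refine WeakPerm.le_iff_inv.2 fun d c hd => (hy d c).2 ⟨hd.1, ?_⟩
    obtain ⟨hlt, hdl, hcb, hcl⟩ := (inv_perm _ _ _).1 (WeakPerm.inv_of_le hv.le hd)
    have : ¬ (d = α.top ∧ c = α.bot) := by rintro ⟨rfl, rfl⟩; exact hvn hd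
    grind
  have hβy : ¬ β.perm ≤ y := by
    intro hc
    have := ((hy _ _).1 (inv_of_perm_le hc)).2
    have := β.bot_lt_top
    grind
  have hβs : β.perm ≤ α.perm ⊔ y := by
    refine perm_le_iff.2 fun d c ⟨hlt, hdl, hcb, hcl⟩ => ?_
    have h1 : ∀ d c, c < d → ((d = α.top ∨ d = β.top) ∧ (c = α.bot ∨ c = β.bot)) →
        (α.perm ⊔ y).Inv d c := by
      rintro d c - ⟨hd, hc⟩
      have h0 : (α.perm ⊔ y).Inv α.top α.bot := inv_of_perm_le le_sup_left
      have h2 : (α.perm ⊔ y).Inv d α.bot := by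
        by_cases e : d = α.top
        · rwa [e]
        · refine WeakPerm.inv_trans (WeakPerm.inv_of_le le_sup_right ((hy _ _).2 ?_)) h0
          grind
      by_cases e : c = α.bot
      · rwa [e]
      · refine WeakPerm.inv_trans h2 (WeakPerm.inv_of_le le_sup_right ((hy _ _).2 ?_))
        grind
    by_cases h2 : (d = α.top ∨ d = β.top) ∧ (c = α.bot ∨ c = β.bot)
    · exact h1 d c hlt h2
    · refine WeakPerm.inv_of_le le_sup_right ((hy _ _).2 ⟨hlt, ?_⟩)
      grind
  have h3 : Θ.r (β.perm ⊓ (α.perm ⊔ y)) (β.perm ⊓ (v ⊔ y)) :=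
    Θ.inf (Θ.refl _) (Θ.sup hr (Θ.refl y))
  rw [inf_eq_left.2 hβs, sup_eq_right.2 hvy] at h3
  exact hβ ⟨_, lt_of_le_of_ne inf_le_left fun e => hβy (inf_eq_left.1 e), h3⟩

/-! ### The congruence of a set of arcs closed under subarcs -/

/-- The subarc of `β` between two points of its range. -/
def restrict (β : Arc n) (c d : Fin n) (h : c < d) : Arc n :=
  ⟨c, d, h, β.left ∩ Finset.Ioo c d, Finset.inter_subset_right⟩

theorem restrict_isSubarc {β : Arc n} {c d : Fin n} (h : c < d) (hc : β.bot ≤ c)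
    (hd : d ≤ β.top) : (β.restrict c d h).IsSubarc β := ⟨hc, hd, rfl⟩

/-- The crucial step for compatibility with joins: an arc of `U` below `x ⊔ z` is already below
`y ⊔ z'` if `y` and `z'` lie above the same arcs of `U` as `x` and `z`. -/
theorem perm_le_sup_of_forall {U : Set (Arc n)}
    (hU : ∀ β ∈ U, ∀ α : Arc n, α.IsSubarc β → α ∈ U) {x y z z' : WeakPerm n}
    (hxy : ∀ β ∈ U, β.perm ≤ x → β.perm ≤ y) (hz : ∀ β ∈ U, β.perm ≤ z → β.perm ≤ z')
    {β : Arc n} (hβ : β ∈ U) (h : β.perm ≤ x ⊔ z) : β.perm ≤ y ⊔ z' := by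
  obtain ⟨m, hm⟩ : ∃ m, m = (β.top : ℕ) - β.bot := ⟨_, rfl⟩
  induction m using Nat.strong_induction_on generalizing β with
  | _ m ih =>
  have hinv := perm_le_iff.1 h
  -- the induction hypothesis in terms of inversions
  have ih' : ∀ c d (hcd : c < d), β.bot ≤ c → d ≤ β.top → (c ≠ β.bot ∨ d ≠ β.top) →
      (β.restrict c d hcd).perm ≤ x ⊔ z → (y ⊔ z').Inv d c := by
    intro c d hcd hc hd hne hle
    refine inv_of_perm_le (ih _ ?_ (hU β hβ _ (restrict_isSubarc hcd hc hd)) hle rfl)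
    have hlt : (d : ℕ) - c < (β.top : ℕ) - β.bot := by
      rw [Fin.lt_def] at hcd
      rw [Fin.le_def] at hc hd
      rw [Ne, Ne, Fin.ext_iff, Fin.ext_iff] at hne
      omega
    rw [hm]
    exact hlt
  have hpair : ∀ d c, β.Pair d c → (c ≠ β.bot ∨ d ≠ β.top) → (y ⊔ z').Inv d c := by
    intro d c hp hne
    refine ih' c d hp.1 hp.2.2.1 hp.le_top hne (perm_le_iff.2 fun f e hq => hinv f e ?_)
    have q5 : f ≤ d := hq.le_top
    obtain ⟨q1, q2, q3, q4⟩ := hq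
    have q3 : c ≤ e := q3
    have q4 : e ∉ β.left ∩ Finset.Ioo c d := q4
    have q6 : f ∈ β.left ∨ f = d := q2.imp (fun h => (Finset.mem_inter.1 h).1) id
    refine ⟨q1, ?_, hp.2.2.1.trans q3, fun he => ?_⟩
    · rcases q6 with q6 | rfl
      · exact Or.inl q6
      · exact hp.2.1
    · rcases q3.lt_or_eq with q3 | rfl
      · exact q4 (Finset.mem_inter.2 ⟨he, Finset.mem_Ioo.2 ⟨q3, q1.trans_le q5⟩⟩)
      · exact hp.2.2.2 he
  have main : (y ⊔ z').Inv β.top β.bot := by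
    by_cases hL : ∃ e ∈ β.left, (x ⊔ z).Inv β.top e
    · -- the highest such `e` gives a shorter subarc below `x ⊔ z`
      obtain ⟨e, ⟨he, hei⟩, hmax⟩ := Set.Finite.exists_maximal
        (Set.toFinite {e | e ∈ β.left ∧ (x ⊔ z).Inv β.top e}) hL
      have hb := mem_left he
      have h1 : (y ⊔ z').Inv e β.bot :=
        hpair e β.bot ⟨hb.1, Or.inl he, le_rfl, β.bot_notMem⟩ (Or.inr hb.2.ne)
      refine WeakPerm.inv_trans (ih' e β.top hb.2 hb.1.le le_rfl (Or.inl hb.1.ne') ?_) h1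
      refine perm_le_iff.2 fun f g hq => ?_
      have q5 : f ≤ β.top := hq.le_top
      obtain ⟨q1, q2, q3, q4⟩ := hq
      have q2 : f ∈ β.left ∩ Finset.Ioo e β.top ∨ f = β.top := q2
      have q3 : e ≤ g := q3
      have q4 : g ∉ β.left ∩ Finset.Ioo e β.top := q4
      have q2' : f ∈ β.left ∨ f = β.top := q2.imp (fun h => (Finset.mem_inter.1 h).1) id
      rcases q3.lt_or_eq with q3 | rfl
      · exact hinv f g ⟨q1, q2', hb.1.le.trans q3.le, fun hg =>
          q4 (Finset.mem_inter.2 ⟨hg, Finset.mem_Ioo.2 ⟨q3, q1.trans_le q5⟩⟩)⟩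
      rcases q5.lt_or_eq with q5 | rfl
      · exact (WeakPerm.inv_cotrans hei q1 q5).resolve_left fun hf =>
          q1.not_ge (hmax ⟨q2'.resolve_right q5.ne, hf⟩ q1.le)
      · exact hei
    by_cases hR : ∃ e, e ∉ β.left ∧ β.bot < e ∧ e < β.top ∧ (x ⊔ z).Inv e β.bot
    · -- the lowest such `e` gives a shorter subarc below `x ⊔ z`
      obtain ⟨e, ⟨he, hb, ht, hei⟩, hmin⟩ := Set.Finite.exists_minimal
        (Set.toFinite {e | e ∉ β.left ∧ β.bot < e ∧ e < β.top ∧ (x ⊔ z).Inv e β.bot}) hR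
      have h1 : (y ⊔ z').Inv β.top e := hpair β.top e ⟨ht, Or.inr rfl, hb.le, he⟩ (Or.inl hb.ne')
      refine WeakPerm.inv_trans h1 (ih' β.bot e hb le_rfl ht.le (Or.inr ht.ne) ?_)
      refine perm_le_iff.2 fun f g hq => ?_
      have q5 : f ≤ e := hq.le_top
      obtain ⟨q1, q2, q3, q4⟩ := hq
      have q2 : f ∈ β.left ∩ Finset.Ioo β.bot e ∨ f = e := q2
      have q3 : β.bot ≤ g := q3
      have q4 : g ∉ β.left ∩ Finset.Ioo β.bot e := q4
      have q4' : g ∉ β.left := fun hg =>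
        q4 (Finset.mem_inter.2 ⟨hg, Finset.mem_Ioo.2 ⟨(mem_left hg).1, q1.trans_le q5⟩⟩)
      rcases q2 with q2 | rfl
      · exact hinv f g ⟨q1, Or.inl (Finset.mem_inter.1 q2).1, q3, q4'⟩
      rcases q3.lt_or_eq with q3 | rfl
      · exact (WeakPerm.inv_cotrans hei q3 q1).resolve_right fun hg =>
          q1.not_ge (hmin ⟨q4', q3, q1.trans ht, hg⟩ q1.le)
      · exact hei
    -- in the remaining case the inversion of the top with the bottom of `β` is not composed of
    -- others, so that `β.perm` is below `x` or below `z`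
    have key : ∀ w : WeakPerm n, w ≤ x ⊔ z → w.Inv β.top β.bot → β.perm ≤ w := fun w hw hi =>
      perm_le_of_not_inv hi (fun c hc hci => hL ⟨c, hc, WeakPerm.inv_of_le hw hci⟩)
        (fun c h1 h2 hc hci => hR ⟨c, hc, h1, h2, WeakPerm.inv_of_le hw hci⟩)
    rcases WeakPerm.inv_sup_cases (inv_of_perm_le h) with hi | hi | ⟨e, h1, h2⟩
    · exact WeakPerm.inv_of_le le_sup_left (inv_of_perm_le (hxy β hβ (key x le_sup_left hi)))
    · exact WeakPerm.inv_of_le le_sup_right (inv_of_perm_le (hz β hβ (key z le_sup_right hi)))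
    · by_cases he : e ∈ β.left
      · exact absurd ⟨e, he, h1⟩ hL
      · exact absurd ⟨e, he, h2.1, h1.1, h2⟩ hR
  refine perm_le_iff.2 fun d c hp => ?_
  by_cases hne : c ≠ β.bot ∨ d ≠ β.top
  · exact hpair d c hp hne
  · push Not at hne
    rwa [hne.1, hne.2]

/-- Two permutations are congruent if they lie above the same join-irreducible permutations of
arcs in `U`. -/
def subarcCon (U : Set (Arc n)) (hU : ∀ β ∈ U, ∀ α : Arc n, α.IsSubarc β → α ∈ U) :
    LatticeCon (WeakPerm n) where
  r x y := ∀ β ∈ U, β.perm ≤ x ↔ β.perm ≤ y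
  iseqv := ⟨fun _ _ _ => Iff.rfl, fun h β hβ => (h β hβ).symm,
    fun h1 h2 β hβ => (h1 β hβ).trans (h2 β hβ)⟩
  inf h1 h2 β hβ := by
    rw [le_inf_iff, le_inf_iff, h1 β hβ, h2 β hβ]
  sup h1 h2 β hβ :=
    ⟨perm_le_sup_of_forall hU (fun β hβ => (h1 β hβ).1) (fun β hβ => (h2 β hβ).1) hβ,
      perm_le_sup_of_forall hU (fun β hβ => (h1 β hβ).2) (fun β hβ => (h2 β hβ).2) hβ⟩

theorem uncontractedArcs_subarcCon (U : Set (Arc n))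
    (hU : ∀ β ∈ U, ∀ α : Arc n, α.IsSubarc β → α ∈ U) :
    uncontractedArcs (subarcCon U hU) = U := by
  ext α
  rw [mem_uncontractedArcs]
  refine ⟨fun h => ?_, ?_⟩
  · by_contra hα
    obtain ⟨w, hw, hwn, hinv⟩ := (corresponds_perm α).exists_lower
    refine h ⟨w, lt_of_le_of_ne hw fun e => hwn (e ▸ (corresponds_perm α).inv), ?_⟩
    intro β hβ
    refine ⟨fun hle => perm_le_iff.2 fun d c hp => ?_, fun hle => hle.trans hw⟩
    refine ((hinv d c).1 (perm_le_iff.1 hle d c hp)).resolve_right ?_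
    rintro ⟨rfl, rfl⟩
    -- `β.perm` contains the inversion of the descent of `α.perm`, so the two coincide
    have := (corresponds_perm α).perm_le hle ((inv_perm _ _ _).2 hp)
    exact hα (perm_injective (le_antisymm this hle) ▸ hβ)
  · rintro hα ⟨w, hw, hr⟩
    exact hw.not_ge ((hr α hα).1 le_rfl)

end Arc

/-! ### Drawings of arcs -/

namespace Arc

variable {n : ℕ}

theorem IsDrawing.lt_of_side_lt {α β : Arc n} {f g : ℝ → ℝ} (hf : α.IsDrawing f)
    (hg : β.IsDrawing g) {c : Fin n} (h1 : α.bot ≤ c) (h2 : c ≤ α.top) (h3 : β.bot ≤ c)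
    (h4 : c ≤ β.top) (h : α.side c < β.side c) : f ((c : ℕ) : ℝ) < g ((c : ℕ) : ℝ) := by
  have key : ∀ {γ : Arc n} {k : ℝ → ℝ}, γ.IsDrawing k → γ.bot ≤ c → c ≤ γ.top →
      (γ.side c = 1 ∧ 0 < k ((c : ℕ) : ℝ)) ∨ (γ.side c = 0 ∧ k ((c : ℕ) : ℝ) = 0) ∨
        (γ.side c = -1 ∧ k ((c : ℕ) : ℝ) < 0) := by
    rintro γ k ⟨-, hb, ht, hk⟩ h1 h2
    rcases h1.eq_or_lt with rfl | h1
    · exact Or.inr (Or.inl ⟨side_bot γ, hb⟩)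
    rcases h2.eq_or_lt with rfl | h2
    · exact Or.inr (Or.inl ⟨side_top γ, ht⟩)
    by_cases hc : c ∈ γ.left
    · exact Or.inl ⟨side_eq_one.2 hc, (hk c h1 h2).1 hc⟩
    · exact Or.inr (Or.inr ⟨by simp [side, hc, h1.ne', h2.ne], (hk c h1 h2).2 hc⟩)
  rcases key hf h1 h2 with ⟨a, a'⟩ | ⟨a, a'⟩ | ⟨a, a'⟩ <;>
    rcases key hg h3 h4 with ⟨b, b'⟩ | ⟨b, b'⟩ | ⟨b, b'⟩ <;> linarith

/-- If each of two arcs is strictly to the left of the other at some point of their common range,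
they cross in between, by the intermediate value theorem. -/
theorem IsNoncrossingDiagram.combNoncrossing {E : Set (Arc n)} (hE : IsNoncrossingDiagram E) :
    CombNoncrossing E := by
  obtain ⟨⟨f, hf, hcross⟩, hE⟩ := hE
  intro α hα β hβ hne
  refine ⟨(hE α hα β hβ hne).1, (hE α hα β hβ hne).2, ?_⟩
  by_contra! hc
  simp only [LeftOf, not_forall, not_le] at hc
  obtain ⟨⟨c, a1, a2, a3, a4, ha⟩, ⟨d, b3, b4, b1, b2, hb⟩⟩ := hc
  have ha := (hf β hβ).lt_of_side_lt (hf α hα) a3 a4 a1 a2 ha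
  have hb := (hf α hα).lt_of_side_lt (hf β hβ) b1 b2 b3 b4 hb
  have cast : ∀ {a b : Fin n}, a ≤ b → ((a : ℕ) : ℝ) ≤ ((b : ℕ) : ℝ) := fun h =>
    Nat.cast_le.2 (Fin.le_def.1 h)
  have sα : Set.uIcc ((c : ℕ) : ℝ) ((d : ℕ) : ℝ) ⊆
      Set.Icc ((α.bot : ℕ) : ℝ) ((α.top : ℕ) : ℝ) :=
    Set.uIcc_subset_Icc ⟨cast a1, cast a2⟩ ⟨cast b1, cast b2⟩
  have sβ : Set.uIcc ((c : ℕ) : ℝ) ((d : ℕ) : ℝ) ⊆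
      Set.Icc ((β.bot : ℕ) : ℝ) ((β.top : ℕ) : ℝ) :=
    Set.uIcc_subset_Icc ⟨cast a3, cast a4⟩ ⟨cast b3, cast b4⟩
  obtain ⟨y, hy, hfy⟩ := isPreconnected_uIcc.intermediate_value₂ Set.right_mem_uIcc
    Set.left_mem_uIcc ((hf α hα).1.mono sα) ((hf β hβ).1.mono sβ) hb.le ha.le
  have hyc : y ≠ ((c : ℕ) : ℝ) := by rintro rfl; exact ha.ne' hfy
  have hyd : y ≠ ((d : ℕ) : ℝ) := by rintro rfl; exact hb.ne hfy
  have h1 := cast a1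
  have h2 := cast a2
  have h3 := cast b1
  have h4 := cast b2
  rcases (hcross α hα β hβ hne y ⟨sα hy, sβ hy⟩ hfy).1 with e | e <;>
    rcases Set.mem_uIcc.1 hy with ⟨l, r⟩ | ⟨l, r⟩
  · exact hyc (by linarith)
  · exact hyd (by linarith)
  · exact hyd (by linarith)
  · exact hyc (by linarith)

/-- The abscissa at height `c` of the curve representing the arc `α` of a descent of `x`.  In the
graph of `x`, this is the signed horizontal distance from the point at height `c` to the middle of
the descent; it is set to `0` at the endpoints of `α`, where the curve meets the vertical line. -/
noncomputable def abscissa (x : WeakPerm n) (α : Arc n) (c : Fin n) : ℝ :=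
  if c = α.bot ∨ c = α.top then 0
  else ((x.toPerm.symm α.top : ℕ) : ℝ) + 1 / 2 - ((x.toPerm.symm c : ℕ) : ℝ)

/-- The curve representing the arc `α` of a descent of `x`, as the piecewise linear interpolation of
`abscissa`. -/
noncomputable def curve (x : WeakPerm n) (α : Arc n) (y : ℝ) : ℝ :=
  ∑ c : Fin n, abscissa x α c * max 0 (1 - |y - ((c : ℕ) : ℝ)|)

theorem curve_natCast (x : WeakPerm n) (α : Arc n) (c : Fin n) :
    curve x α ((c : ℕ) : ℝ) = abscissa x α c := by
  rw [curve, Finset.sum_eq_single c]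
  · simp
  · intro d _ hd
    have h1 : (1 : ℝ) ≤ |((c : ℕ) : ℝ) - ((d : ℕ) : ℝ)| := by
      have : (1 : ℤ) ≤ |((c : ℕ) : ℤ) - ((d : ℕ) : ℤ)| := by
        refine Int.one_le_abs ?_
        rw [Ne, Fin.ext_iff] at hd
        omega
      exact_mod_cast this
    rw [max_eq_left (by linarith), mul_zero]
  · simp

theorem Corresponds.isDrawing_curve {x : WeakPerm n} {α : Arc n} (h : Corresponds x α) :
    α.IsDrawing (curve x α) := by
  obtain ⟨-, h2⟩ := corresponds_iff.1 h
  refine ⟨?_, by simp [curve_natCast, abscissa], by simp [curve_natCast, abscissa],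
    fun c hb ht => ?_⟩
  · unfold curve
    fun_prop
  · rw [curve_natCast, abscissa, if_neg (by simp [hb.ne', ht.ne]), h2 c hb ht, Fin.lt_def]
    constructor
    · intro hc
      have : ((x.toPerm.symm c : ℕ) : ℝ) < ((x.toPerm.symm α.top : ℕ) : ℝ) := by exact_mod_cast hc
      linarith
    · intro hc
      have h3 : (x.toPerm.symm c : ℕ) ≠ x.toPerm.symm α.top := fun e =>
        ht.ne (x.toPerm.symm.injective (Fin.ext e))
      have : ((x.toPerm.symm α.top : ℕ) : ℝ) + 1 ≤ ((x.toPerm.symm c : ℕ) : ℝ) := by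
        exact_mod_cast (show (x.toPerm.symm α.top : ℕ) + 1 ≤ x.toPerm.symm c by omega)
      linarith

/-- Of two descents, the one further left has its curve further left. -/
theorem Corresponds.abscissa_le {x : WeakPerm n} {α β : Arc n} (hα : Corresponds x α)
    (hβ : Corresponds x β) (h : x.toPerm.symm α.top < x.toPerm.symm β.top) (c : Fin n) :
    abscissa x α c ≤ abscissa x β c ∧ (abscissa x α c = abscissa x β c →
      (c = α.bot ∨ c = α.top) ∧ (c = β.bot ∨ c = β.top)) := by
  have h1 := (corresponds_iff.1 hα).1
  have h2 := (corresponds_iff.1 hβ).1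
  have h3 : ((x.toPerm.symm α.top : ℕ) : ℝ) + 1 ≤ ((x.toPerm.symm β.top : ℕ) : ℝ) := by
    exact_mod_cast h
  have h1 : ((x.toPerm.symm α.bot : ℕ) : ℝ) = ((x.toPerm.symm α.top : ℕ) : ℝ) + 1 := by
    exact_mod_cast h1
  have h2 : ((x.toPerm.symm β.bot : ℕ) : ℝ) = ((x.toPerm.symm β.top : ℕ) : ℝ) + 1 := by
    exact_mod_cast h2
  unfold abscissa
  split_ifs with e1 e2 e2
  · exact ⟨le_rfl, fun _ => ⟨e1, e2⟩⟩
  · have : 0 < ((x.toPerm.symm β.top : ℕ) : ℝ) + 1 / 2 - ((x.toPerm.symm c : ℕ) : ℝ) := by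
      rcases e1 with rfl | rfl <;> linarith
    exact ⟨this.le, fun e => absurd e this.ne⟩
  · have : ((x.toPerm.symm α.top : ℕ) : ℝ) + 1 / 2 - ((x.toPerm.symm c : ℕ) : ℝ) < 0 := by
      rcases e2 with rfl | rfl <;> linarith
    exact ⟨this.le, fun e => absurd e this.ne⟩
  · exact ⟨by linarith, fun e => by linarith⟩

theorem Corresponds.endpoints_of_curve_eq {x : WeakPerm n} {α β : Arc n} (hα : Corresponds x α)
    (hβ : Corresponds x β) (h : x.toPerm.symm α.top < x.toPerm.symm β.top) {y : ℝ}
    (hy : y ∈ Set.Icc ((α.bot : ℕ) : ℝ) ((α.top : ℕ) : ℝ)) (he : curve x α y = curve x β y) :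
    (y = ((α.bot : ℕ) : ℝ) ∨ y = ((α.top : ℕ) : ℝ)) ∧
      (y = ((β.bot : ℕ) : ℝ) ∨ y = ((β.top : ℕ) : ℝ)) := by
  have hle := hα.abscissa_le hβ h
  -- each point at distance less than 1 from `y` is an endpoint of both arcs
  have key : ∀ c : Fin n, |y - ((c : ℕ) : ℝ)| < 1 →
      (c = α.bot ∨ c = α.top) ∧ (c = β.bot ∨ c = β.top) := by
    intro c hc
    refine (hle c).2 ?_
    have := (Finset.sum_eq_sum_iff_of_le fun c _ => mul_le_mul_of_nonneg_right (hle c).1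
      (le_max_left 0 (1 - |y - ((c : ℕ) : ℝ)|))).1 he c (Finset.mem_univ c)
    exact mul_right_cancel₀ (lt_max_of_lt_right (by linarith)).ne' this
  have h0 : 0 ≤ y := (Nat.cast_nonneg _).trans hy.1
  have hfl := Nat.floor_le h0
  have hlf := Nat.lt_floor_add_one y
  have hmt : ⌊y⌋₊ ≤ α.top := by exact_mod_cast hfl.trans hy.2
  have hm := key ⟨⌊y⌋₊, hmt.trans_lt α.top.is_lt⟩
    (by rw [abs_lt]; constructor <;> simp <;> linarith)
  rcases hfl.eq_or_lt with e | hlt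
  · rw [← e]
    simpa [Fin.ext_iff] using hm
  · -- otherwise two consecutive points would be the endpoints of both arcs
    exfalso
    have hmt' : ⌊y⌋₊ + 1 ≤ α.top := by
      have : ((⌊y⌋₊ : ℕ) : ℝ) < ((α.top : ℕ) : ℝ) := hlt.trans_le hy.2
      exact_mod_cast this
    have hm' := key ⟨⌊y⌋₊ + 1, hmt'.trans_lt α.top.is_lt⟩
      (by rw [abs_lt]; constructor <;> simp <;> linarith)
    have ha := Fin.lt_def.1 α.bot_lt_top
    have hb := Fin.lt_def.1 β.bot_lt_top
    have hab : α.bot = β.bot := by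
      simp only [Fin.ext_iff] at hm hm' ⊢
      omega
    rw [hα.eq_of_bot hβ hab] at h
    exact h.false

theorem isNoncrossingDiagram_corresponds (x : WeakPerm n) :
    IsNoncrossingDiagram {α | Corresponds x α} := by
  refine ⟨⟨curve x, fun α hα => Corresponds.isDrawing_curve hα, ?_⟩, ?_⟩
  · intro α hα β hβ hne y hy he
    have hne' : x.toPerm.symm α.top ≠ x.toPerm.symm β.top := fun e =>
      hne (Corresponds.eq_of_top hα hβ (x.toPerm.symm.injective e))
    rcases lt_or_gt_of_ne hne' with h | h
    · exact Corresponds.endpoints_of_curve_eq hα hβ h hy.1 he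
    · exact (Corresponds.endpoints_of_curve_eq hβ hα h hy.2 he.symm).symm
  · exact fun α hα β hβ hne => ⟨fun e => hne (Corresponds.eq_of_bot hα hβ e),
      fun e => hne (Corresponds.eq_of_top hα hβ e)⟩

end Arc

/-! ### The bijection -/

theorem bijOn_arcDiagram (n : ℕ) :
    Set.BijOn (arcDiagram (n := n)) Set.univ {E | Arc.IsNoncrossingDiagram E} := by
  refine ⟨fun x _ => ?_, arcDiagram_injective.injOn, fun E hE => ?_⟩
  · rw [Set.mem_ofPred_eq, arcDiagram_eq]
    exact Arc.isNoncrossingDiagram_corresponds x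
  · obtain ⟨x, hx⟩ :=
      (Arc.IsNoncrossingDiagram.combNoncrossing hE).exists_corresponds_iff
    exact ⟨x, trivial, by rw [arcDiagram_eq]; exact Set.ext hx⟩

theorem encard_arcDiagram {n : ℕ} (x : WeakPerm n) :
    (arcDiagram x).encard = x.descents.encard := by
  rw [arcDiagram_eq]
  have h : Set.BijOn (fun α : Arc n => x.toPerm.symm α.top) {α | Arc.Corresponds x α}
      x.descents := by
    refine ⟨?_, ?_, ?_⟩
    · intro α hα
      refine ⟨x.toPerm.symm α.bot, (Arc.corresponds_iff.1 hα).1, ?_⟩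
      simpa using α.bot_lt_top
    · exact fun α hα β hβ h => Arc.Corresponds.eq_of_top hα hβ (x.toPerm.symm.injective h)
    · rintro i ⟨j, hij, hlt⟩
      obtain ⟨α, hα, ht, -⟩ := Arc.exists_corresponds hij hlt
      exact ⟨α, hα, by simp [ht]⟩
  rw [← h.image_eq, h.injOn.encard_image]

theorem not_contracts_iff_arcDiagram_subset {n : ℕ} {Θ : LatticeCon (WeakPerm n)}
    {x : WeakPerm n} : ¬ Θ.Contracts x ↔ arcDiagram x ⊆ uncontractedArcs Θ := by
  rw [Arc.not_contracts_iff, arcDiagram_eq]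
  exact Iff.rfl

theorem mainTheorem7 (n : ℕ) (U : Set (Arc n)) :
    ((∃ Θ : LatticeCon (WeakPerm n), U = uncontractedArcs Θ) ↔
      ∀ β ∈ U, ∀ α : Arc n, α.IsSubarc β → α ∈ U) ∧
    ∀ Θ : LatticeCon (WeakPerm n), U = uncontractedArcs Θ →
      Set.BijOn arcDiagram {x : WeakPerm n | ¬ Θ.Contracts x}
        {E : Set (Arc n) | Arc.IsNoncrossingDiagram E ∧ E ⊆ U} ∧
      ∀ k : ℕ, Set.BijOn arcDiagram
        {x : WeakPerm n | ¬ Θ.Contracts x ∧ x.descents.encard = k}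
        {E : Set (Arc n) | Arc.IsNoncrossingDiagram E ∧ E.encard = k ∧ E ⊆ U} := by
  obtain ⟨hmaps, -, hsurj⟩ := bijOn_arcDiagram n
  refine ⟨⟨?_, fun hU => ⟨Arc.subarcCon U hU, (Arc.uncontractedArcs_subarcCon U hU).symm⟩⟩, ?_⟩
  · rintro ⟨Θ, rfl⟩ β hβ α hα
    exact Arc.mem_uncontractedArcs_of_isSubarc hβ hα
  rintro Θ rfl
  refine ⟨⟨fun x hx => ⟨hmaps trivial, not_contracts_iff_arcDiagram_subset.1 hx⟩,
    arcDiagram_injective.injOn, ?_⟩, fun k => ⟨fun x hx => ⟨hmaps trivial, ?_,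
    not_contracts_iff_arcDiagram_subset.1 hx.1⟩, arcDiagram_injective.injOn, ?_⟩⟩
  · rintro E ⟨hE, hEU⟩
    obtain ⟨x, -, rfl⟩ := hsurj hE
    exact ⟨x, not_contracts_iff_arcDiagram_subset.2 hEU, rfl⟩
  · rw [encard_arcDiagram]
    exact hx.2
  · rintro E ⟨hE, hEk, hEU⟩
    obtain ⟨x, -, rfl⟩ := hsurj hE
    exact ⟨x, ⟨not_contracts_iff_arcDiagram_subset.2 hEU, by rw [← encard_arcDiagram]; exact hEk⟩,
      rfl⟩
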